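/- All graphs are finite and simple. A *linear forest* is a forest each of whose connected components is a path (an isolated vertex being allowed as a component). For an integer $k\ge 0$, let $\mathcal L_k$ be the family of all linear forests with exactly $k$ edges and without isolated vertices; a graph is *$\mathcal L_k$-free* if it contains no subgraph isomorphic to a member of $\mathcal L_k$. For integers $a\ge 0$ and $2a\le k\le n$, let $H(n,k,a)$ be the $n$-vertex graph whose vertex set is partitioned into $A,B,C$ with $|A|=a$, $|B|=k-2a$, $|C|=n-k+a$, and whose edges are all pairs of vertices inside $A\cup B$ and all pairs between $A$ and $C$. Let $H^+(n,k,a)$ (respectively $H^{++}(n,k,a)$) be the graph obtained from $H(n,k,a)$ by adding one edge (respectively two vertex-disjoint edges) inside $C$. Put $$h_r(n,k,a)=\binom{k-a}{r}+(n-k+a)\binom{a}{r-1},$$ where $\binom{m}{j}=0$ unless $0\le j\le m$. Let $N_r(G)$ be the number of $r$-cliques (complete subgraphs on $r$ vertices) of $G$. **Theorem.** Let $n,k,d,r$ be nonnegative integers with $n>k^5$ and $r\le\lfloor\frac{k-3}{2}\rfloor$. Let $G$ be an $\mathcal L_k$-free graph on $n$ vertices with minimum degree at least $d$ such that $$N_r(G)>\max\left\{h_r(n,k,d),\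 h_r\left(n,k,\left\lfloor\tfrac{k-5}{2}\right\rfloor\right)\right\}.$$ (i) If $k$ is odd, then $G$ is isomorphic to a (not necessarily induced) subgraph of $H\left(n,k,\lfloor\frac{k-1}{2}\rfloor\right)$, of $H\left(n,k,\lfloor\frac{k-3}{2}\rfloor\right)$, or of $H^+\left(n,k-1,\lfloor\frac{k-3}{2}\rfloor\right)$. (ii) If $k$ is even, then $G$ is isomorphic to a (not necessarily induced) subgraph of $H\left(n,k,\lfloor\frac{k-1}{2}\rfloor\right)$, of $H\left(n,k,\lfloor\frac{k-3}{2}\rfloor\right)$, of $H^+\left(n,k-1,\lfloor\frac{k-3}{2}\rfloor\right)$, or of $H^{++}\left(n,k-2,\lfloor\frac{k-3}{2}\rfloor\right)$. -/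

import Mathlib

/-- A linear forest: a forest each of whose connected components is a path
(`SimpleGraph.pathGraph (m + 1)` has `m + 1` vertices; for `m = 0` it is an isolated vertex). -/
def IsLinearForest {W : Type*} (F : SimpleGraph W) : Prop :=
  F.IsAcyclic ∧ ∀ c : F.ConnectedComponent,
    ∃ m : ℕ, Nonempty (c.toSimpleGraph ≃g SimpleGraph.pathGraph (m + 1))

/-- Membership in the family `L_k`: linear forests of size `k` (that is, with exactly `k` edges)
without isolated vertices. -/
def MemLinearForestFamily (k : ℕ) {W : Type*} (F : SimpleGraph W) : Prop :=
  IsLinearForest F ∧ F.edgeSet.ncard = k ∧ ∀ v : W, ∃ w : W, F.Adj v w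

/-- `G` is `L_k`-free: no member of `L_k` is isomorphic to a (not necessarily induced) subgraph
of `G`. Every finite graph is isomorphic to one with vertex set some `Fin m`. -/
def LinearForestFree (k : ℕ) {V : Type*} (G : SimpleGraph V) : Prop :=
  ∀ (m : ℕ) (F : SimpleGraph (Fin m)), MemLinearForestFamily k F → F.Free G

/-- The graph `H(n, k, a)` (for `2 * a ≤ k ≤ n`), on the vertices `0, …, n - 1`, with
`A = {i < a}`, `B = {a ≤ i < k - a}`, `C = {k - a ≤ i}`, so that `|A| = a`, `|B| = k - 2a`,
`|C| = n - k + a`. Its edges are all pairs inside `A ∪ B` and all pairs between `A` and `C`. -/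
def graphH (n k a : ℕ) : SimpleGraph (Fin n) where
  Adj i j := i ≠ j ∧
    ((i.val < k - a ∧ j.val < k - a) ∨ (i.val < a ∧ k - a ≤ j.val) ∨
      (j.val < a ∧ k - a ≤ i.val))
  symm := ⟨by
    rintro i j ⟨hne, h⟩
    exact ⟨hne.symm, by tauto⟩⟩
  loopless := ⟨fun _ h => h.1 rfl⟩

/-- `H⁺(n, k, a)`: one edge inside `C`, joining its first two vertices, is added to
`H(n, k, a)`. -/
def graphHPlus (n k a : ℕ) : SimpleGraph (Fin n) :=
  graphH n k a ⊔
    SimpleGraph.fromRel (fun i j : Fin n => i.val = k - a ∧ j.val = k - a + 1)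

/-- `H⁺⁺(n, k, a)`: two independent edges inside `C`, on its first four vertices, are added to
`H(n, k, a)`. -/
def graphHPlusPlus (n k a : ℕ) : SimpleGraph (Fin n) :=
  graphH n k a ⊔
    SimpleGraph.fromRel (fun i j : Fin n =>
      (i.val = k - a ∧ j.val = k - a + 1) ∨ (i.val = k - a + 2 ∧ j.val = k - a + 3))

/-- `h_r(n, k, a) = C(k - a, r) + (n - k + a) C(a, r - 1)`, where `C(a, -1) = 0`. -/
def hCliques : (r n k a : ℕ) → ℕ
  | 0, _, k, a => (k - a).choose 0
  | r + 1, n, k, a => (k - a).choose (r + 1) + (n - k + a) * a.choose r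

/-! A linear forest in `G` is encoded by a repetition-free list of vertices, its edges being the
adjacent consecutive pairs; `links` counts them. Being free of `L_k` then yields `LinksLT G k`, a
form suited to cutting, reversing and inserting.

If two non-adjacent vertices have degree sum at least `k`, joining them keeps `LinksLT`
(`LinksLT.sup_edge`, a rotation argument in the style of Bondy and Chvátal). So `G` may be enlarged
to a closed graph, in which non-adjacent vertices have degree sum below `k`. There the set `A` of
vertices of degree at least `k` consists of universal vertices. Each universal vertex can be
inserted into a long list with a gain of two links, so `G` without `A` has no linear forest of size
`m = k - 2|A|` (`exists_isCore`).

Let `t = ⌊(k-5)/2⌋`. If `|A| ≤ t`, the number of cliques contradicts the hypothesis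
(`IsCore.card_cliqueFinset_le`). A clique on at least `k - t` vertices forces small degrees outside
it, and convexity of `h_r` in its last argument gives the bound by the maximum. Without such a
clique and with `|A| < t`, all but `O(k²)` vertices have degree at most `t - 1` or lie in a small
clique, and `n > k^5` decides. If `|A| = t`, then `m` is 5 or 6, and a smallest path cover shows
that the graph outside `A` has at most `m.choose 2` edges, whence no more cliques than in `H(n, k,
t)`.

So `|A| > t`, that is `m ≤ 4`. Closed graphs with so few links are classified by hand
(`LinksLT.structure_three`, `LinksLT.structure_four`), and joining them to `A` gives subgraphs of
the listed graphs (`IsCore.isContained`). -/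

namespace LinearForests

variable {V : Type*}

/-! ### Adjacent consecutive pairs in lists -/

open scoped Classical in
/-- The number of consecutive pairs of a list that are adjacent in `G`. -/
noncomputable def links (G : SimpleGraph V) : List V → ℕ
  | x :: y :: l => (if G.Adj x y then 1 else 0) + links G (y :: l)
  | _ => 0

/-- Every repetition-free list of vertices has fewer than `k` adjacent consecutive pairs. -/
def LinksLT (G : SimpleGraph V) (k : ℕ) : Prop :=
  ∀ l : List V, l.Nodup → links G l < k

variable {G : SimpleGraph V}

@[simp] lemma links_nil : links G [] = 0 := rfl

@[simp] lemma links_singleton (x : V) : links G [x] = 0 := rfl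

open scoped Classical in
lemma links_cons_cons (x y : V) (l : List V) :
    links G (x :: y :: l) = (if G.Adj x y then 1 else 0) + links G (y :: l) := rfl

open scoped Classical in
lemma links_append (p : List V) (x y : V) (q : List V) :
    links G (p ++ x :: y :: q) =
      links G (p ++ [x]) + (if G.Adj x y then 1 else 0) + links G (y :: q) := by
  induction p with
  | nil => simp [links_cons_cons]
  | cons a p ih =>
    cases p with
    | nil => simp [links_cons_cons]; ring
    | cons b p =>
      simp only [List.cons_append, links_cons_cons] at ih ⊢
      rw [ih]; ring

lemma links_add_le_links_append (p q : List V) :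
    links G p + links G q ≤ links G (p ++ q) := by
  rcases List.eq_nil_or_concat p with rfl | ⟨p, x, rfl⟩
  · simp
  · cases q with
    | nil => simp
    | cons y q =>
      have := links_append (G := G) p x y q
      simp only [List.concat_eq_append, List.append_assoc, List.cons_append, List.nil_append]
      omega

lemma links_reverse (l : List V) : links G l.reverse = links G l := by
  induction l with
  | nil => rfl
  | cons x l ih =>
    cases l with
    | nil => rfl
    | cons y l =>
      have := links_append (G := G) l.reverse y x []
      simp only [List.reverse_cons, List.append_assoc, List.cons_append, List.nil_append,
        links_singleton] at this ih ⊢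
      rw [this, ih, links_cons_cons, G.adj_comm]
      ring

lemma links_mono {G' : SimpleGraph V} (h : G ≤ G') (l : List V) : links G l ≤ links G' l := by
  induction l with
  | nil => simp
  | cons x l ih =>
    cases l with
    | nil => simp
    | cons y l =>
      rw [links_cons_cons, links_cons_cons]
      have := @h x y
      split_ifs <;> first | omega | tauto

lemma links_lt_length {l : List V} (hl : l ≠ []) : links G l < l.length := by
  induction l with
  | nil => simp at hl
  | cons x l ih =>
    cases l with
    | nil => simp
    | cons y l =>
      rw [links_cons_cons]
      have := ih (by simp)
      simp only [List.length_cons] at this ⊢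
      split_ifs <;> omega

lemma links_le_links_cons (x : V) (l : List V) : links G l ≤ links G (x :: l) := by
  simpa using links_add_le_links_append (G := G) [x] l

/-- A list that is not a walk splits at a non-adjacent consecutive pair. -/
lemma exists_not_adj_of_links_add_one_lt {l : List V} (h : links G l + 1 < l.length) :
    ∃ p x y q, l = p ++ x :: y :: q ∧ ¬ G.Adj x y := by
  induction l with
  | nil => simp at h
  | cons x l ih =>
    cases l with
    | nil => simp at h
    | cons y l =>
      by_cases hxy : G.Adj x y
      · rw [links_cons_cons, if_pos hxy] at h
        obtain ⟨p, u, v, q, h1, h2⟩ := ih (by simp only [List.length_cons] at h ⊢; omega)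
        exact ⟨x :: p, u, v, q, by rw [h1]; rfl, h2⟩
      · exact ⟨[], x, y, l, rfl, hxy⟩

open scoped Classical in
/-- Adjacent consecutive pairs, counted by position. -/
lemma links_eq_card (l : List V) :
    links G l = {i : ℕ | ∃ h : i + 1 < l.length, G.Adj l[i] l[i + 1]}.ncard := by
  induction l with
  | nil => simp
  | cons x l ih =>
    cases l with
    | nil => simp
    | cons y l =>
      rw [links_cons_cons, ih]
      set S := {i : ℕ | ∃ h : i + 1 < (y :: l).length, G.Adj (y :: l)[i] (y :: l)[i + 1]} with hS
      have hfin : S.Finite :=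
        (Set.finite_lt_nat (y :: l).length).subset fun i hi => by
          obtain ⟨h, -⟩ := hi
          exact Nat.lt_of_succ_lt h
      have key : {i : ℕ | ∃ h : i + 1 < (x :: y :: l).length,
          G.Adj (x :: y :: l)[i] (x :: y :: l)[i + 1]} =
          (if G.Adj x y then {0} else ∅) ∪ Nat.succ '' S := by
        ext i
        cases i with
        | zero => by_cases h : G.Adj x y <;> simp [h]
        | succ i => by_cases h : G.Adj x y <;> simp [h, hS]
      rw [key, Set.ncard_union_eq _ _ (hfin.image _),
        Set.ncard_image_of_injective _ Nat.succ_injective]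
      · split_ifs <;> simp
      · split_ifs <;> simp
      · split_ifs <;> simp

/-! ### Graphs whose edges join consecutive numbers -/

section Consecutive

variable {N : ℕ} {F : SimpleGraph (Fin N)}

/-- All edges join consecutive numbers. -/
def Consecutive (F : SimpleGraph (Fin N)) : Prop :=
  ∀ i j, F.Adj i j → i.val + 1 = j.val ∨ j.val + 1 = i.val

/-- A walk moves by one at each step, so it can pass from the numbers up to `i` to the larger ones
only along the pair `i j`. -/
lemma Consecutive.le_iff_of_reachable (hF : Consecutive F) {i j : Fin N}
    (hij : i.val + 1 = j.val) (hadj : ¬ F.Adj i j) {u v : Fin N} (h : F.Reachable u v) :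
    u ≤ i ↔ v ≤ i := by
  obtain ⟨w⟩ := h
  induction w with
  | nil => rfl
  | @cons a b c hab _ ih =>
    rw [← ih]
    have h1 := hF _ _ hab
    have h2 : ¬ (a = i ∧ b = j) := by rintro ⟨rfl, rfl⟩; exact hadj hab
    have h3 : ¬ (b = i ∧ a = j) := by rintro ⟨rfl, rfl⟩; exact hadj hab.symm
    simp only [Fin.ext_iff, Fin.le_def] at *
    omega

lemma Consecutive.isAcyclic (hF : Consecutive F) : F.IsAcyclic := by
  rw [SimpleGraph.isAcyclic_iff_forall_adj_isBridge]
  have key : ∀ v w : Fin N, v.val + 1 = w.val → F.Adj v w → F.IsBridge s(v, w) := by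
    intro v w hvw hadj
    rw [SimpleGraph.isBridge_iff]
    intro hr
    have hF' : Consecutive (F.deleteEdges {s(v, w)}) :=
      fun i j h => hF i j (SimpleGraph.deleteEdges_le _ h)
    have := hF'.le_iff_of_reachable hvw (by simp) hr
    simp only [Fin.le_def] at this
    omega
  intro v w hvw
  rcases hF v w hvw with h | h
  · exact key v w h hvw
  · rw [Sym2.eq_swap]; exact key w v h hvw.symm

/-- A component contains every number between two of its members, so its increasing enumeration
turns the covering relation of `Fin (m + 1)`, which defines `pathGraph`, into adjacency. -/
lemma Consecutive.isLinearForest (hF : Consecutive F) : IsLinearForest F := by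
  classical
  refine ⟨hF.isAcyclic, fun c => ?_⟩
  have hne : 0 < c.supp.toFinset.card := by
    rw [Finset.card_pos]
    exact c.nonempty_supp.imp fun x hx => by simpa using hx
  obtain ⟨m, hm⟩ : ∃ m, c.supp.toFinset.card = m + 1 := ⟨_, (Nat.succ_pred_eq_of_pos hne).symm⟩
  have covers : ∀ x y : c.supp.toFinset, x ⋖ y → F.Adj x.1 y.1 := by
    intro x y hxy
    have hlt : x.1.val < y.1.val := hxy.lt
    have hx : x.1 ∈ c.supp := Set.mem_toFinset.1 x.2
    have hy : y.1 ∈ c.supp := Set.mem_toFinset.1 y.2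
    have hr : F.Reachable x.1 y.1 := c.reachable_of_mem_supp hx hy
    set z : Fin N := ⟨x.1.val + 1, by omega⟩ with hz
    have hadj : F.Adj x.1 z := by
      by_contra hn
      have := hF.le_iff_of_reachable (j := z) rfl hn hr
      simp only [Fin.le_def] at this
      omega
    have hzs : z ∈ c.supp.toFinset := by
      simpa using c.mem_supp_of_adj_mem_supp hx hadj
    have : (⟨z, hzs⟩ : c.supp.toFinset) = y := by
      by_contra hne
      refine hxy.2 (c := ⟨z, hzs⟩) (Fin.lt_def.2 (by simp [hz])) ?_
      have hne' : z.val ≠ y.1.val := fun h => hne (Subtype.ext (Fin.ext h))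
      refine Fin.lt_def.2 ?_
      simp only [hz] at hne' ⊢
      omega
    rw [← this]; exact hadj
  have covby : ∀ x y : c.supp.toFinset, x.1.val + 1 = y.1.val → x ⋖ y := by
    intro x y hxy
    refine ⟨Fin.lt_def.2 (by omega), fun z h1 h2 => ?_⟩
    have h1' : x.1.val < z.1.val := h1
    have h2' : z.1.val < y.1.val := h2
    omega
  let e := c.supp.toFinset.orderIsoOfFin hm
  let e' : c.supp.toFinset ≃ c := Equiv.subtypeEquivRight fun x => Set.mem_toFinset
  refine ⟨m, ⟨SimpleGraph.Iso.symm ⟨e.toEquiv.trans e', ?_⟩⟩⟩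
  intro i j
  have h1 : c.toSimpleGraph.Adj ((e.toEquiv.trans e') i) ((e.toEquiv.trans e') j) ↔
      F.Adj (e i).1 (e j).1 := Iff.rfl
  rw [h1, SimpleGraph.pathGraph, SimpleGraph.hasse_adj, ← apply_covBy_apply_iff e,
    ← apply_covBy_apply_iff e]
  constructor
  · intro h
    rcases hF _ _ h with h | h
    · exact Or.inl (covby _ _ h)
    · exact Or.inr (covby _ _ h)
  · rintro (h | h)
    · exact covers _ _ h
    · exact (covers _ _ h).symm

end Consecutive

/-! ### From forbidden linear forests to lists -/

/-- The linear forest traced by a list of vertices. -/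
def listForest (G : SimpleGraph V) (l : List V) : SimpleGraph (Fin l.length) where
  Adj i j := (i.val + 1 = j.val ∨ j.val + 1 = i.val) ∧ G.Adj l[i] l[j]
  symm := ⟨fun _ _ h => ⟨h.1.symm, h.2.symm⟩⟩
  loopless := ⟨fun _ h => h.2.ne rfl⟩

lemma ncard_edgeSet_listForest (l : List V) : (listForest G l).edgeSet.ncard = links G l := by
  classical
  rw [links_eq_card]
  symm
  refine Set.ncard_congr (fun i hi => s(⟨i, Nat.lt_of_succ_lt hi.1⟩, ⟨i + 1, hi.1⟩)) ?_ ?_ ?_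
  · rintro i ⟨h, hadj⟩
    exact ⟨Or.inl rfl, hadj⟩
  · intro i j hi hj h
    simp only [Sym2.eq_iff, Fin.mk.injEq] at h
    omega
  · intro e he
    induction e with
    | h u v =>
      obtain ⟨h | h, hadj⟩ := he
      · refine ⟨u.val, ⟨h ▸ v.2, ?_⟩, ?_⟩
        · simpa [h] using hadj
        · simp [h]
      · refine ⟨v.val, ⟨h ▸ u.2, ?_⟩, ?_⟩
        · simpa [h] using hadj.symm
        · simp [h, Sym2.eq_swap]

/-- A shortest list with at least `k` links traces a member of the family: dropping its head loses
at most one link, so there are exactly `k`, and an entry without a link to either side could be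
removed at no loss, so no vertex is isolated. -/
lemma linksLT_of_linearForestFree {k : ℕ} (h : LinearForestFree k G) : LinksLT G k := by
  classical
  by_contra hcon
  simp only [LinksLT, not_forall, not_lt] at hcon
  have hex : ∃ N, ∃ l : List V, l.Nodup ∧ k ≤ links G l ∧ l.length = N := by
    obtain ⟨l, h1, h2⟩ := hcon
    exact ⟨_, l, h1, h2, rfl⟩
  obtain ⟨l, hl, hk, hlen⟩ := Nat.find_spec hex
  have hmin : ∀ l' : List V, l'.Nodup → k ≤ links G l' → l.length ≤ l'.length := fun l' h1 h2 => by
    rw [hlen]; exact Nat.find_min' hex ⟨l', h1, h2, rfl⟩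
  have hlinks : links G l = k := by
    by_contra hne
    cases l with
    | nil => simp only [links_nil] at hk hne; omega
    | cons x l =>
      have h1 := hmin l hl.of_cons (by
        cases l with
        | nil => simp only [links_singleton] at hk hne; omega
        | cons y l =>
          rw [links_cons_cons] at hk hne
          split_ifs at hk hne <;> omega)
      simp at h1
  refine h l.length (listForest G l) ⟨Consecutive.isLinearForest fun i j hij => hij.1,
    by rw [ncard_edgeSet_listForest, hlinks], ?_⟩
    ⟨⟨⟨fun i => l[i], fun {a b} hab => hab.2⟩, ?_⟩⟩
  · intro v
    by_contra hcon
    push Not at hcon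
    have hsplit : l = l.take v.val ++ l[v] :: l.drop (v.val + 1) := by simp
    have hsub : (l.take v.val ++ l.drop (v.val + 1)).Sublist l := by
      conv_rhs => rw [hsplit]
      exact (List.Sublist.refl _).append (List.sublist_cons_self _ _)
    have hlt : (l.take v.val ++ l.drop (v.val + 1)).length < l.length := by
      have := v.2
      simp only [List.length_append, List.length_take, List.length_drop]; omega
    refine absurd (hmin _ (hl.sublist hsub) ?_) (not_le.2 hlt)
    refine le_trans ?_ (links_add_le_links_append _ _)
    rw [← hlinks]
    conv_lhs => rw [hsplit]
    have hright : links G (l[v] :: l.drop (v.val + 1)) = links G (l.drop (v.val + 1)) := by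
      by_cases hv : v.val + 1 < l.length
      · have h0 := hcon ⟨v.val + 1, hv⟩
        rw [List.drop_eq_getElem_cons hv, links_cons_cons, if_neg, zero_add]
        exact fun h => h0 ⟨Or.inl rfl, h⟩
      · rw [List.drop_eq_nil_of_le (by omega)]; simp
    by_cases hv : 0 < v.val
    · have h0 := hcon ⟨v.val - 1, by omega⟩
      have htake : l.take v.val = l.take (v.val - 1) ++ [l[v.val - 1]] := by
        rw [List.take_append_getElem]; congr 1; omega
      have h1 := links_append (G := G) (l.take (v.val - 1)) l[v.val - 1] l[v]
        (l.drop (v.val + 1))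
      rw [if_neg (fun h => h0 ⟨Or.inr (by simp; omega), h.symm⟩), hright, ← htake] at h1
      have h2 : l.take v.val ++ l[v] :: l.drop (v.val + 1) =
          l.take (v.val - 1) ++ l[v.val - 1] :: l[v] :: l.drop (v.val + 1) := by
        rw [htake, List.append_assoc]; rfl
      rw [h2, h1]
      omega
    · have h0 : l.take v.val = [] := by
        rw [show v.val = 0 by omega, List.take_zero]
      rw [h0, List.nil_append, links_nil, zero_add]
      exact hright.le
  · intro i j hij
    exact Fin.ext ((hl.getElem_inj_iff).1 hij)

/-! ### Closure under joining vertices of large degree sum -/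

lemma links_append_of_adj {A B : List V} {a b : V} (hA : A.getLast? = some a)
    (hB : B.head? = some b) (h : G.Adj a b) : links G (A ++ B) = links G A + 1 + links G B := by
  obtain ⟨A', rfl⟩ := List.getLast?_eq_some_iff.1 hA
  obtain ⟨B', rfl⟩ := List.head?_eq_some_iff.1 hB
  have := links_append (G := G) A' a b B'
  rw [if_pos h] at this
  simpa using this

lemma links_append_of_not_adj {A B : List V} {a b : V} (hA : A.getLast? = some a)
    (hB : B.head? = some b) (h : ¬ G.Adj a b) : links G (A ++ B) = links G A + links G B := by
  obtain ⟨A', rfl⟩ := List.getLast?_eq_some_iff.1 hA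
  obtain ⟨B', rfl⟩ := List.head?_eq_some_iff.1 hB
  have := links_append (G := G) A' a b B'
  rw [if_neg h] at this
  simpa using this

lemma links_sup_edge_of_notMem {u v x : V} (hx : x = u ∨ x = v) {l : List V} (hl : x ∉ l) :
    links (G ⊔ SimpleGraph.edge u v) l = links G l := by
  induction l with
  | nil => rfl
  | cons a l ih =>
    cases l with
    | nil => rfl
    | cons b l =>
      rw [links_cons_cons, links_cons_cons, ih (fun h => hl (List.mem_cons_of_mem _ h))]
      have : (G ⊔ SimpleGraph.edge u v).Adj a b ↔ G.Adj a b := by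
        simp only [List.mem_cons, not_or] at hl
        rw [SimpleGraph.sup_adj, SimpleGraph.edge_adj]
        grind
      rw [this]

/-- A repetition-free list uses an added edge at most once. -/
lemma links_sup_edge {u v : V} {l : List V} (hl : l.Nodup)
    (h : links G l < links (G ⊔ SimpleGraph.edge u v) l) :
    ∃ p x y q, l = p ++ x :: y :: q ∧ ((x = u ∧ y = v) ∨ (x = v ∧ y = u)) ∧
      links (G ⊔ SimpleGraph.edge u v) l = links G (p ++ [x]) + 1 + links G (y :: q) := by
  induction l with
  | nil => simp at h
  | cons a l ih =>
    cases l with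
    | nil => simp at h
    | cons b l =>
      by_cases hab : (a = u ∧ b = v) ∨ (a = v ∧ b = u)
      · refine ⟨[], a, b, l, rfl, hab, ?_⟩
        have ha : a ∉ b :: l := (List.nodup_cons.1 hl).1
        have hne : a ≠ b := fun h => ha (by simp [h])
        rw [links_cons_cons, links_sup_edge_of_notMem (hab.imp And.left And.left) ha, if_pos]
        · simp
        · rw [SimpleGraph.sup_adj, SimpleGraph.edge_adj]
          grind
      · have hadj : (G ⊔ SimpleGraph.edge u v).Adj a b ↔ G.Adj a b := by
          rw [SimpleGraph.sup_adj, SimpleGraph.edge_adj]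
          grind
        rw [links_cons_cons, links_cons_cons, hadj] at h
        obtain ⟨p, x, y, q, h1, h2, h3⟩ := ih hl.of_cons (by omega)
        refine ⟨a :: p, x, y, q, by rw [h1]; rfl, h2, ?_⟩
        rw [links_cons_cons, h3, hadj]
        cases p with
        | nil =>
          obtain ⟨rfl, -⟩ : b = x ∧ l = y :: q := by simpa using h1
          simp [links_cons_cons]; ring
        | cons c p =>
          obtain ⟨rfl, -⟩ : b = c ∧ l = p ++ x :: y :: q := by simpa using h1
          simp only [List.cons_append, links_cons_cons]; ring

open scoped Classical in
-- Every entry but the last is a left member of one consecutive pair and every entry but the first a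
-- right member. With `α` and `β` the adjacency to the last and to the first entry, the left side
-- becomes a degree sum.
lemma sum_dropLast_add_sum_tail_le_links (α β : V → ℕ) (l : List V)
    (h : ∀ p s t q, l = p ++ s :: t :: q → α s + β t ≤ if G.Adj s t then 1 else 0) :
    (l.dropLast.map α).sum + (l.tail.map β).sum ≤ links G l := by
  induction l with
  | nil => simp
  | cons x l ih =>
    cases l with
    | nil => simp
    | cons y l =>
      have h1 := h [] x y l rfl
      have h2 := ih fun p s t q hl => h (x :: p) s t q (by rw [hl]; rfl)
      rw [links_cons_cons]
      simp only [List.dropLast_cons_cons, List.map_cons, List.sum_cons, List.tail_cons] at h2 ⊢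
      omega

lemma degree_eq_sum_list [Fintype V] [DecidableRel G.Adj] {L : List V} (hL : L.Nodup)
    (hfull : ∀ v, v ∈ L) (u : V) :
    G.degree u = (L.map fun v => if G.Adj u v then 1 else 0).sum := by
  classical
  rw [← List.sum_toFinset _ hL, Finset.sum_ite, Finset.sum_const_zero, add_zero, ← Finset.card_eq_sum_ones,
    ← SimpleGraph.card_neighborFinset_eq_degree]
  congr 1
  ext v
  simp [hfull]

/-- A list of all vertices between two non-adjacent vertices that realises the maximum number of
links bounds the degree sum of its ends. -/
lemma degree_add_degree_le_links [Fintype V] [DecidableRel G.Adj] {k : ℕ} (h : LinksLT G k)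
    {x y : V} {L : List V} (hL : L.Nodup) (hfull : ∀ v, v ∈ L)
    (hhead : L.head? = some y) (hlast : L.getLast? = some x) (hk : k ≤ links G L + 1)
    (hlen : k < L.length) :
    G.degree x + G.degree y ≤ links G L := by
  classical
  have hlt := h L hL
  have key := sum_dropLast_add_sum_tail_le_links (G := G)
    (fun s => if G.Adj x s then 1 else 0) (fun t => if G.Adj y t then 1 else 0) L ?_
  · rw [degree_eq_sum_list hL hfull, degree_eq_sum_list hL hfull]
    obtain ⟨L1, h1⟩ := List.getLast?_eq_some_iff.1 hlast
    obtain ⟨L2, h2⟩ := List.head?_eq_some_iff.1 hhead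
    have e1 : (L.map fun v => if G.Adj x v then 1 else 0).sum =
        (L.dropLast.map fun v => if G.Adj x v then 1 else 0).sum := by
      rw [h1]; simp
    have e2 : (L.map fun v => if G.Adj y v then 1 else 0).sum =
        (L.tail.map fun v => if G.Adj y v then 1 else 0).sum := by
      rw [h2]; simp
    rw [e1, e2]
    exact key
  · intro p s t q hsplit
    have hsplit' : L = (p ++ [s]) ++ (t :: q) := by simp [hsplit]
    have hA : (p ++ [s]).getLast? = some s := by simp
    have hB : (t :: q).head? = some t := rfl
    have hA' : (p ++ [s]).head? = some y := by
      rw [hsplit'] at hhead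
      cases p <;> simpa using hhead
    have hB' : (t :: q).getLast? = some x := by
      rwa [hsplit', List.getLast?_append_of_ne_nil _ (by simp)] at hlast
    generalize p ++ [s] = A at *
    generalize t :: q = B at *
    clear hsplit
    subst hsplit'
    have hperm1 : (A ++ B.reverse).Nodup := by
      refine ((List.Perm.append_left A (List.reverse_perm B)).nodup_iff).2 hL
    have hperm2 : (A.reverse ++ B).Nodup := by
      refine ((List.Perm.append_right B (List.reverse_perm A)).nodup_iff).2 hL
    -- Here `L = A ++ B`, where `A` runs from `y` to `s` and `B` from `t` to `x`. A pair `s t`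
    -- contributes at most its own link to the two degrees, since otherwise a rearrangement would
    -- reach `k` links.
    by_cases hst : G.Adj s t
    · rw [if_pos hst]
      by_contra hcon
      have hxs : G.Adj x s := by by_contra hn; simp only [hn] at hcon; split_ifs at hcon <;> omega
      have hyt : G.Adj y t := by by_contra hn; simp only [hn] at hcon; split_ifs at hcon <;> omega
      have hl := links_append_of_adj hA hB hst
      have hl2 := links_append_of_adj (A := A.reverse) (a := y) (by simpa using hA') hB hyt
      rw [links_reverse] at hl2
      -- The list `A.reverse ++ B` has as many links as `L` and closes up cyclically along `x s`. As
      -- it has more than `k` entries, some consecutive pair `a b` is no link, and opening the cycle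
      -- there gains one.
      have hnab : ∃ p0 a b q0, A.reverse ++ B = p0 ++ a :: b :: q0 ∧ ¬ G.Adj a b :=
        exists_not_adj_of_links_add_one_lt (by
          simp only [List.length_append, List.length_reverse] at hlen ⊢; omega)
      obtain ⟨p0, a, b, q0, hR, hab⟩ := hnab
      have hR' : A.reverse ++ B = (p0 ++ [a]) ++ (b :: q0) := by simp [hR]
      have hhead' : (p0 ++ [a]).head? = some s := by
        have : (A.reverse ++ B).head? = some s := by
          rw [List.head?_append, List.head?_reverse, hA]; rfl
        rw [hR'] at this
        cases p0 <;> simpa using this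
      have hlast' : (b :: q0).getLast? = some x := by
        have : (A.reverse ++ B).getLast? = some x := by
          rw [List.getLast?_append, hB']; rfl
        rwa [hR', List.getLast?_append_of_ne_nil _ (by simp)] at this
      have e1 := links_append_of_not_adj (A := p0 ++ [a]) (B := b :: q0) (a := a) (b := b)
        (by simp) rfl hab
      have e2 := links_append_of_adj hlast' hhead' hxs
      rw [← hR'] at e1
      have := h ((b :: q0) ++ (p0 ++ [a])) (by
        rw [(List.perm_append_comm).nodup_iff, ← hR']; exact hperm2)
      omega
    · rw [if_neg hst]
      have hl := links_append_of_not_adj hA hB hst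
      -- Reversing one half replaces the non-link `s t` by `s x` or by `y t`.
      have hxs : ¬ G.Adj x s := fun hadj => by
        have e := links_append_of_adj (B := B.reverse) (b := x) hA (by simpa using hB') hadj.symm
        rw [links_reverse] at e
        have := h _ hperm1
        omega
      have hyt : ¬ G.Adj y t := fun hadj => by
        have e := links_append_of_adj (A := A.reverse) (a := y) (by simpa using hA') hB hadj
        rw [links_reverse] at e
        have := h _ hperm2
        omega
      simp [hxs, hyt]

/-- Adding an edge of large degree sum does not create a larger linear forest. -/
lemma LinksLT.sup_edge [Fintype V] [DecidableRel G.Adj] {k : ℕ} (h : LinksLT G k)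
    (hcard : k < Fintype.card V) {u v : V} (huv : ¬ G.Adj u v)
    (hdeg : k ≤ G.degree u + G.degree v) : LinksLT (G ⊔ SimpleGraph.edge u v) k := by
  classical
  intro l hl
  by_contra hk
  push Not at hk
  have hGl := h l hl
  obtain ⟨p, x, y, q, hsplit, hcase, hlinks⟩ := links_sup_edge hl (hGl.trans_le hk)
  have hxy : ¬ G.Adj x y := by
    rcases hcase with ⟨rfl, rfl⟩ | ⟨rfl, rfl⟩
    · exact huv
    · exact fun h => huv h.symm
  have hdeg' : k ≤ G.degree x + G.degree y := by
    rcases hcase with ⟨rfl, rfl⟩ | ⟨rfl, rfl⟩ <;> omega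
  set rest := (Finset.univ.filter fun w => w ∉ l).toList with hrest
  -- Cutting at the new edge and swapping the two pieces puts `y` first and `x` last and loses only
  -- that edge; `rest` makes the list exhaust all vertices.
  set L := (y :: q) ++ (rest ++ (p ++ [x])) with hLdef
  have hperm : L.Perm (rest ++ l) := by
    have : l = (p ++ [x]) ++ (y :: q) := by simp [hsplit]
    rw [this, hLdef]
    refine (List.perm_append_comm).trans ?_
    simp
  have hL : L.Nodup := by
    rw [hperm.nodup_iff, List.nodup_append]
    refine ⟨Finset.nodup_toList _, hl, ?_⟩
    rintro a ha b hb rfl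
    simp [hrest] at ha
    exact ha hb
  have hfull : ∀ w, w ∈ L := by
    intro w
    rw [hperm.mem_iff]
    by_cases hw : w ∈ l <;> simp [hrest, hw]
  have hlen : k < L.length := by
    rw [← List.toFinset_card_of_nodup hL]
    have : L.toFinset = Finset.univ := by ext w; simp [hfull]
    rwa [this, Finset.card_univ]
  have hge : links G (y :: q) + links G (p ++ [x]) ≤ links G L := by
    refine le_trans ?_ (links_add_le_links_append _ _)
    have := links_add_le_links_append (G := G) rest (p ++ [x])
    omega
  have := degree_add_degree_le_links (x := x) (y := y) h hL hfull (by simp [hLdef])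
    (by rw [hLdef, ← List.append_assoc, ← List.append_assoc, List.getLast?_append]; rfl) (by omega) hlen
  have := h L hL
  omega

/-- A graph with few links extends to one in which non-adjacent vertices have a small degree
sum. -/
lemma LinksLT.exists_closure [Fintype V] {k : ℕ} (h : LinksLT G k)
    (hcard : k < Fintype.card V) :
    ∃ G' : SimpleGraph V, G ≤ G' ∧ LinksLT G' k ∧
      ∀ [DecidableRel G'.Adj] (u v : V), u ≠ v → ¬ G'.Adj u v → G'.degree u + G'.degree v < k := by
  classical
  obtain ⟨G', hle, hmax⟩ := (Set.toFinite {G' : SimpleGraph V | LinksLT G' k}).exists_le_maximal h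
  refine ⟨G', hle, hmax.1, fun {_} u v hne huv => ?_⟩
  by_contra hcon
  have h1 := LinksLT.sup_edge hmax.1 hcard huv (not_lt.1 hcon)
  have h2 : (G' ⊔ SimpleGraph.edge u v) ≤ G' := hmax.2 h1 le_sup_left
  exact huv (h2 (by rw [SimpleGraph.sup_adj, SimpleGraph.edge_adj]; exact Or.inr ⟨by simp, hne⟩))

/-! ### Universal vertices and the core -/

/-- The graph `G` with all edges meeting `A` removed. -/
def off (G : SimpleGraph V) (A : Finset V) : SimpleGraph V where
  Adj u v := G.Adj u v ∧ u ∉ A ∧ v ∉ A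
  symm := ⟨fun _ _ h => ⟨h.1.symm, h.2.2, h.2.1⟩⟩
  loopless := ⟨fun _ h => h.1.ne rfl⟩

lemma off_adj {A : Finset V} {u v : V} : (off G A).Adj u v ↔ G.Adj u v ∧ u ∉ A ∧ v ∉ A := Iff.rfl

lemma off_le (A : Finset V) : off G A ≤ G := fun _ _ h => h.1

/-- Inserted between two consecutive non-adjacent entries, `v` breaks no link and creates two. -/
lemma exists_perm_cons_links_eq_add_two {l : List V} {v : V} (hv : ∀ w ∈ l, G.Adj v w)
    (hlen : links G l + 1 < l.length) :
    ∃ l' : List V, l'.Perm (v :: l) ∧ links G l' = links G l + 2 := by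
  obtain ⟨p, x, y, q, rfl, hxy⟩ := exists_not_adj_of_links_add_one_lt hlen
  refine ⟨p ++ x :: v :: y :: q, ?_, ?_⟩
  · have : p ++ x :: v :: y :: q = (p ++ [x]) ++ v :: y :: q := by simp
    rw [this]
    refine List.perm_middle.trans ?_
    simp
  · rw [links_append, links_append p x y q, if_neg hxy, if_pos (hv x (by simp)).symm,
      links_cons_cons, if_pos (hv y (by simp))]
    ring

/-- Universal vertices can be inserted into a long list, each creating two new links. -/
lemma LinksLT.exists_insert [DecidableEq V] {k : ℕ} (h : LinksLT G k) {l : List V} (hl : l.Nodup)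
    (hlen : k < l.length) (A : Finset V) (hA : ∀ v ∈ A, ∀ w, w ≠ v → G.Adj v w)
    (hdisj : ∀ v ∈ A, v ∉ l) :
    ∃ l' : List V, l'.Nodup ∧ k < l'.length ∧ (∀ w, w ∈ l' ↔ w ∈ l ∨ w ∈ A) ∧
      links G l + 2 * A.card ≤ links G l' := by
  induction A using Finset.induction_on with
  | empty => exact ⟨l, hl, hlen, by simp, by simp⟩
  | insert a A ha ih =>
    obtain ⟨l', h1, h2, h3, h4⟩ := ih (fun v hv => hA v (Finset.mem_insert_of_mem hv))
      (fun v hv => hdisj v (Finset.mem_insert_of_mem hv))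
    have hal : a ∉ l' := by
      rw [h3]; exact not_or.2 ⟨hdisj a (Finset.mem_insert_self _ _), ha⟩
    have hlt := h l' h1
    obtain ⟨l'', h5, h6⟩ := exists_perm_cons_links_eq_add_two (G := G) (l := l') (v := a)
      (fun w hw => hA a (Finset.mem_insert_self _ _) w (by rintro rfl; exact hal hw)) (by omega)
    refine ⟨l'', h5.nodup_iff.2 (List.nodup_cons.2 ⟨hal, h1⟩), ?_, ?_, ?_⟩
    · rw [h5.length_eq, List.length_cons]; omega
    · intro w
      rw [h5.mem_iff, List.mem_cons, h3, Finset.mem_insert]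
      tauto
    · rw [Finset.card_insert_of_notMem ha]; omega

lemma links_off_le_links_filter [DecidableEq V] (A : Finset V) (l : List V) :
    links (off G A) l ≤ links (off G A) (l.filter fun v => v ∉ A) := by
  induction l with
  | nil => simp
  | cons x l ih =>
    cases l with
    | nil => simp
    | cons y l =>
      rw [links_cons_cons]
      by_cases hx : x ∈ A
      · rw [if_neg (fun h => h.2.1 hx), List.filter_cons_of_neg (by simpa using hx)]
        omega
      · rw [List.filter_cons_of_pos (by simpa using hx)]
        by_cases hy : y ∈ A
        · rw [if_neg (fun h => h.2.2 hy), zero_add]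
          exact ih.trans (links_le_links_cons _ _)
        · rw [List.filter_cons_of_pos (by simpa using hy)] at ih ⊢
          rw [links_cons_cons]
          omega

/-- Deleting a set of universal vertices lowers the size of the largest linear forest by twice
their number. -/
lemma LinksLT.links_off_add_lt [Fintype V] [DecidableEq V] {k : ℕ} (h : LinksLT G k)
    {A : Finset V} (hA : ∀ v ∈ A, ∀ w, w ≠ v → G.Adj v w) (hcard : k + A.card < Fintype.card V)
    {l : List V} (hl : l.Nodup) : links (off G A) l + 2 * A.card < k := by
  classical
  set rest := (Finset.univ.filter fun w => w ∉ l ∧ w ∉ A).toList with hrest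
  -- All vertices outside `A` are listed, so that the length exceeds `k` and there is room for every
  -- insertion.
  set L := (l.filter fun v => v ∉ A) ++ rest with hLdef
  have hL : L.Nodup := by
    rw [hLdef, List.nodup_append]
    refine ⟨hl.filter _, Finset.nodup_toList _, ?_⟩
    rintro a ha b hb rfl
    simp [hrest] at ha hb
    exact hb.1 ha.1
  have hmem : ∀ w, w ∈ L ↔ w ∉ A := by
    intro w
    by_cases h1 : w ∈ A <;> by_cases h2 : w ∈ l <;> simp [hLdef, hrest, h1, h2]
  have hlen : k < L.length := by
    rw [← List.toFinset_card_of_nodup hL]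
    have : L.toFinset = Aᶜ := by ext w; simp [hmem]
    rw [this, Finset.card_compl]
    omega
  obtain ⟨l', h1, -, -, h4⟩ := h.exists_insert hL hlen A hA fun v hv hv' => (hmem v).1 hv' hv
  have h5 := h l' h1
  have h6 := links_off_le_links_filter (G := G) A l
  have h7 := links_add_le_links_append (G := off G A) (l.filter fun v => v ∉ A) rest
  rw [← hLdef] at h7
  have h8 := links_mono (off_le (G := G) A) L
  omega

/-- The vertices that are not isolated. -/
noncomputable def nonIsolated [Fintype V] (G : SimpleGraph V) : Finset V := by
  classical exact Finset.univ.filter fun v => ∃ w, G.Adj v w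

lemma mem_nonIsolated [Fintype V] {v : V} : v ∈ nonIsolated G ↔ ∃ w, G.Adj v w := by
  classical
  simp [nonIsolated]

/-- A graph of bounded degree with many non-isolated vertices has a large matching. -/
lemma exists_list_links_of_card_nonIsolated [Fintype V] [DecidableRel G.Adj] {Δ : ℕ}
    (hΔ : ∀ v, G.degree v + 1 ≤ Δ) (j : ℕ) (hj : 2 * j * Δ < (nonIsolated G).card + 2 * Δ) :
    ∃ l : List V, l.Nodup ∧ l.length = 2 * j ∧ j ≤ links G l := by
  classical
  induction j with
  | zero => exact ⟨[], by simp, rfl, by simp⟩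
  | succ j ih =>
    obtain ⟨l, h1, h2, h3⟩ := ih (by nlinarith)
    -- The union of the closed neighbourhoods of the matched vertices: an edge at a vertex outside
    -- it avoids the whole matching.
    set S := l.toFinset.biUnion fun v => insert v (G.neighborFinset v) with hS
    have hScard : S.card ≤ 2 * j * Δ := by
      refine Finset.card_biUnion_le.trans ?_
      rw [← h2, ← List.toFinset_card_of_nodup h1, ← smul_eq_mul]
      refine Finset.sum_le_card_nsmul _ _ _ fun v _ => ?_
      exact (Finset.card_insert_le _ _).trans (by simpa using hΔ v)
    obtain ⟨x, hx, hxS⟩ : ∃ x ∈ nonIsolated G, x ∉ S := by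
      by_contra hcon
      push Not at hcon
      have := Finset.card_le_card (show nonIsolated G ⊆ S from hcon)
      nlinarith
    obtain ⟨y, hxy⟩ := mem_nonIsolated.1 hx
    have hxl : x ∉ l := fun h => hxS (by
      rw [hS, Finset.mem_biUnion]; exact ⟨x, by simpa using h, by simp⟩)
    have hyl : y ∉ l := fun h => hxS (by
      rw [hS, Finset.mem_biUnion]; exact ⟨y, by simpa using h, by simp [hxy.symm]⟩)
    refine ⟨x :: y :: l, ?_, by simp [h2]; ring, ?_⟩
    · simp [hxl, hyl, h1, hxy.ne]
    · rw [links_cons_cons, if_pos hxy]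
      have := links_le_links_cons (G := G) y l
      omega

section

variable [Fintype V]

open scoped Classical

/-- `A` is a set of universal vertices of `G`, the graph `off G A` has no linear forest of size `m`
and is closed under joining vertices of degree sum at least `m`. -/
structure IsCore (G : SimpleGraph V) (k : ℕ) (A : Finset V) (m : ℕ) : Prop where
  card_add : 2 * A.card + m = k
  pos : 0 < m
  universal : ∀ v ∈ A, ∀ w, w ≠ v → G.Adj v w
  linksLT : LinksLT (off G A) m
  degree_lt : ∀ v, (off G A).degree v < m
  closed : ∀ u v, u ≠ v → ¬ (off G A).Adj u v → (off G A).degree u + (off G A).degree v < m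
  card_nonIsolated : (nonIsolated (off G A)).card ≤ 2 * k * k
  degree_eq : ∀ v, v ∉ A → G.degree v = (off G A).degree v + A.card
  exists_isolated : ∃ w, w ∉ A ∧ (off G A).degree w = 0

lemma degree_off_of_mem {A : Finset V} {v : V} (hv : v ∈ A) : (off G A).degree v = 0 := by
  rw [SimpleGraph.degree_eq_zero]
  intro w h
  exact h.2.1 hv

lemma degree_eq_degree_off_add {A : Finset V} (hA : ∀ v ∈ A, ∀ w, w ≠ v → G.Adj v w) {v : V}
    (hv : v ∉ A) : G.degree v = (off G A).degree v + A.card := by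
  rw [← SimpleGraph.card_neighborFinset_eq_degree, ← SimpleGraph.card_neighborFinset_eq_degree,
    ← Finset.card_union_of_disjoint]
  · congr 1
    ext w
    simp only [SimpleGraph.mem_neighborFinset, Finset.mem_union, off_adj]
    constructor
    · intro h
      by_cases hw : w ∈ A <;> simp [h, hv, hw]
    · rintro (h | h)
      · exact h.1
      · exact (hA w h v (by rintro rfl; exact hv h)).symm
  · rw [Finset.disjoint_left]
    intro w hw hwA
    rw [SimpleGraph.mem_neighborFinset] at hw
    exact hw.2.2 hwA

/-- Take the vertices of degree at least `k`; closedness makes them universal. Outside them degrees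
are below `k`, so a large set of non-isolated vertices would contain a matching of size `k`. The
isolated vertices that remain sharpen the degree bound to `m`. -/
lemma exists_isCore {k : ℕ} (h : LinksLT G k)
    (hclosed : ∀ u v, u ≠ v → ¬ G.Adj u v → G.degree u + G.degree v < k)
    (hcard : 2 * k * k + 2 * k < Fintype.card V) : ∃ A m, IsCore G k A m := by
  set A := Finset.univ.filter fun v => k ≤ G.degree v with hAdef
  have hA : ∀ v ∈ A, ∀ w, w ≠ v → G.Adj v w := by
    intro v hv w hne
    by_contra hn
    have h1 := hclosed v w hne.symm hn
    have h2 : k ≤ G.degree v := by simpa [hAdef] using hv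
    omega
  -- Inserting `k` universal vertices would already give `2 * k` links. This rough bound makes `n`
  -- large enough to treat all of `A` at once.
  have hAk : A.card < k := by
    by_contra hn
    obtain ⟨B, hBA, hB⟩ := Finset.exists_subset_card_eq (not_lt.1 hn)
    have := h.links_off_add_lt (A := B) (fun v hv => hA v (hBA hv)) (by omega)
      (List.nodup_nil)
    omega
  have hlinks : ∀ l : List V, l.Nodup → links (off G A) l + 2 * A.card < k := fun l hl =>
    h.links_off_add_lt hA (by omega) hl
  have h2A : 2 * A.card < k := by simpa using hlinks [] List.nodup_nil
  have hLT : LinksLT (off G A) (k - 2 * A.card) := fun l hl => by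
    have := hlinks l hl; omega
  have hdeg : ∀ v, (off G A).degree v + 1 ≤ k := by
    intro v
    by_cases hv : v ∈ A
    · rw [degree_off_of_mem hv]; omega
    · have h1 := degree_eq_degree_off_add hA hv
      have h2 : ¬ k ≤ G.degree v := by simpa [hAdef] using hv
      omega
  have hT : (nonIsolated (off G A)).card ≤ 2 * k * k := by
    by_contra hn
    obtain ⟨l, h1, -, h3⟩ := exists_list_links_of_card_nonIsolated hdeg k (by omega)
    have := hlinks l h1
    omega
  obtain ⟨w, hw⟩ : ∃ w, w ∉ A ∪ nonIsolated (off G A) := by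
    by_contra hn
    push Not at hn
    have h1 : (Finset.univ : Finset V) ⊆ A ∪ nonIsolated (off G A) := fun w _ => hn w
    have h2 := Finset.card_le_card h1
    have h3 := Finset.card_union_le A (nonIsolated (off G A))
    rw [Finset.card_univ] at h2
    omega
  rw [Finset.mem_union, not_or, mem_nonIsolated, not_exists] at hw
  have hw0 : (off G A).degree w = 0 := by
    rw [SimpleGraph.degree_eq_zero]
    exact fun v hv => hw.2 v hv
  have hlt : ∀ v, (off G A).degree v < k - 2 * A.card := by
    intro v
    by_cases hv : v ∈ A
    · rw [degree_off_of_mem hv]; omega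
    · rcases eq_or_ne v w with rfl | hne
      · omega
      -- In `G` the isolated vertex `w` still has degree `|A|`, and `v` has `|A|` more than outside
      -- `A`, so the degree sum yields the bound `k - 2|A|`.
      · have h1 := hclosed v w hne fun h => hw.2 v ⟨h.symm, hw.1, hv⟩
        rw [degree_eq_degree_off_add hA hv, degree_eq_degree_off_add hA hw.1] at h1
        omega
  refine ⟨A, k - 2 * A.card, by omega, by omega, hA, hLT, hlt, ?_, hT,
    fun v hv => degree_eq_degree_off_add hA hv, w, hw.1, hw0⟩
  intro u v hne huv
  by_cases hu : u ∈ A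
  · rw [degree_off_of_mem hu, zero_add]; exact hlt v
  · by_cases hv : v ∈ A
    · rw [degree_off_of_mem hv, add_zero]; exact hlt u
    · have h1 := hclosed u v hne fun h => huv ⟨h, hu, hv⟩
      rw [degree_eq_degree_off_add hA hu, degree_eq_degree_off_add hA hv] at h1
      omega

end

/-! ### Upper bounds for the number of cliques -/

section

variable [Fintype V]

open scoped Classical

/-- Every `r`-clique lies in `K` or contains a vertex outside `K`. -/
lemma card_cliqueFinset_le_choose_add_sum (K : Finset V) (r : ℕ) :
    (G.cliqueFinset (r + 1)).card ≤
      K.card.choose (r + 1) + ∑ v ∈ Kᶜ, (G.degree v).choose r := by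
  have hsub : G.cliqueFinset (r + 1) ⊆ K.powersetCard (r + 1) ∪
      Kᶜ.biUnion fun v => ((G.neighborFinset v).powersetCard r).image (insert v) := by
    intro Q hQ
    rw [SimpleGraph.mem_cliqueFinset_iff] at hQ
    rw [Finset.mem_union, Finset.mem_powersetCard]
    by_cases hQK : Q ⊆ K
    · exact Or.inl ⟨hQK, hQ.card_eq⟩
    · right
      obtain ⟨v, hv, hvK⟩ := Finset.not_subset.1 hQK
      rw [Finset.mem_biUnion]
      refine ⟨v, by simpa using hvK, Finset.mem_image.2 ⟨Q.erase v, ?_, Finset.insert_erase hv⟩⟩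
      rw [Finset.mem_powersetCard, Finset.card_erase_of_mem hv, hQ.card_eq]
      refine ⟨fun w hw => ?_, rfl⟩
      rw [SimpleGraph.mem_neighborFinset]
      exact hQ.isClique hv (Finset.mem_of_mem_erase hw) (Finset.ne_of_mem_erase hw).symm
  refine (Finset.card_le_card hsub).trans ((Finset.card_union_le _ _).trans ?_)
  rw [Finset.card_powersetCard]
  refine Nat.add_le_add_left (Finset.card_biUnion_le.trans (Finset.sum_le_sum fun v _ => ?_)) _
  refine Finset.card_image_le.trans ?_
  rw [Finset.card_powersetCard, SimpleGraph.card_neighborFinset_eq_degree]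

/-- Cliques split into a part inside `A` and a part outside `A`. -/
lemma card_cliqueFinset_le_sum_mul_choose (A : Finset V) (r : ℕ) :
    (G.cliqueFinset r).card ≤ ∑ p ∈ Finset.HasAntidiagonal.antidiagonal r,
      ((G.cliqueFinset p.1).filter fun Q => Disjoint Q A).card * A.card.choose p.2 := by
  have hsub : G.cliqueFinset r ⊆ (Finset.HasAntidiagonal.antidiagonal r).biUnion fun p =>
      (((G.cliqueFinset p.1).filter fun Q => Disjoint Q A) ×ˢ A.powersetCard p.2).image
        fun q => q.1 ∪ q.2 := by
    intro Q hQ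
    rw [SimpleGraph.mem_cliqueFinset_iff] at hQ
    rw [Finset.mem_biUnion]
    refine ⟨((Q \ A).card, (Q ∩ A).card), ?_, ?_⟩
    · rw [Finset.HasAntidiagonal.mem_antidiagonal, Finset.card_sdiff_add_card_inter, hQ.card_eq]
    · refine Finset.mem_image.2 ⟨(Q \ A, Q ∩ A), ?_, by simp [Finset.sdiff_union_inter]⟩
      rw [Finset.mem_product, Finset.mem_filter, Finset.mem_powersetCard,
        SimpleGraph.mem_cliqueFinset_iff]
      exact ⟨⟨⟨hQ.isClique.subset (by simp), rfl⟩,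
        Finset.sdiff_disjoint⟩, Finset.inter_subset_right, rfl⟩
  refine (Finset.card_le_card hsub).trans (Finset.card_biUnion_le.trans
    (Finset.sum_le_sum fun p _ => Finset.card_image_le.trans ?_))
  rw [Finset.card_product, Finset.card_powersetCard]

/-- In a graph of bounded degree a `j`-clique extends to few `(j + 1)`-cliques. -/
lemma card_cliqueFinset_succ_mul_le {D j : ℕ} (hj : 0 < j) (hD : ∀ v, G.degree v < D) :
    (G.cliqueFinset (j + 1)).card * (j + 1) ≤ (G.cliqueFinset j).card * (D - j) := by
  refine Finset.card_mul_le_card_mul (fun Q' Q => Q ⊆ Q') ?_ ?_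
  · intro Q' hQ'
    rw [SimpleGraph.mem_cliqueFinset_iff] at hQ'
    have hsub : Q'.image (fun v => Q'.erase v) ⊆
        Finset.bipartiteAbove (fun Q' Q => Q ⊆ Q') (G.cliqueFinset j) Q' := by
      intro Q hQ
      obtain ⟨v, hv, rfl⟩ := Finset.mem_image.1 hQ
      rw [Finset.mem_bipartiteAbove, SimpleGraph.mem_cliqueFinset_iff]
      exact ⟨by simpa using hQ'.erase_of_mem hv, Finset.erase_subset _ _⟩
    refine le_trans ?_ (Finset.card_le_card hsub)
    rw [Finset.card_image_of_injOn, hQ'.card_eq]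
    intro u hu v hv huv
    by_contra hne
    have : u ∈ Q'.erase v := Finset.mem_erase.2 ⟨hne, hu⟩
    have huv' : Q'.erase u = Q'.erase v := huv
    rw [← huv'] at this
    simp at this
  · intro Q hQ
    rw [SimpleGraph.mem_cliqueFinset_iff] at hQ
    obtain ⟨q, hq⟩ : Q.Nonempty := Finset.card_pos.1 (by rw [hQ.card_eq]; exact hj)
    -- An extending vertex is a neighbour of a fixed `q ∈ Q`. Of the at most `D - 1` neighbours of
    -- `q`, `j - 1` lie in `Q`, which leaves `D - j`.
    have hsub : Finset.bipartiteBelow (fun Q' Q => Q ⊆ Q') (G.cliqueFinset (j + 1)) Q ⊆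
        (G.neighborFinset q \ Q.erase q).image fun v => insert v Q := by
      intro Q' hQ'
      rw [Finset.mem_bipartiteBelow, SimpleGraph.mem_cliqueFinset_iff] at hQ'
      obtain ⟨hQ', hQQ'⟩ := hQ'
      have hcard : (Q' \ Q).card = 1 := by
        rw [Finset.card_sdiff_of_subset hQQ', hQ'.card_eq, hQ.card_eq]; omega
      obtain ⟨v, hv⟩ := Finset.card_eq_one.1 hcard
      have hvm : v ∈ Q' \ Q := by rw [hv]; simp
      rw [Finset.mem_sdiff] at hvm
      refine Finset.mem_image.2 ⟨v, ?_, ?_⟩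
      · rw [Finset.mem_sdiff, SimpleGraph.mem_neighborFinset]
        refine ⟨hQ'.isClique (hQQ' hq) hvm.1 ?_, fun h => hvm.2 (Finset.mem_of_mem_erase h)⟩
        rintro rfl; exact hvm.2 hq
      · rw [Finset.insert_eq, ← hv, Finset.sdiff_union_of_subset hQQ']
    refine (Finset.card_le_card hsub).trans (Finset.card_image_le.trans ?_)
    have hQN : Q.erase q ⊆ G.neighborFinset q := by
      intro w hw
      rw [SimpleGraph.mem_neighborFinset]
      exact hQ.isClique hq (Finset.mem_of_mem_erase hw) (Finset.ne_of_mem_erase hw).symm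
    rw [Finset.card_sdiff_of_subset hQN, Finset.card_erase_of_mem hq, hQ.card_eq,
      SimpleGraph.card_neighborFinset_eq_degree]
    have := hD q
    omega

/-- A graph of maximum degree below `m` with at most `m.choose 2` edges has at most `m.choose j`
cliques of size `j ≥ 2`. -/
lemma card_cliqueFinset_le_choose_of_edges {m : ℕ} (hD : ∀ v, G.degree v < m)
    (he : (G.cliqueFinset 2).card ≤ m.choose 2) (j : ℕ) (hj : 2 ≤ j) :
    (G.cliqueFinset j).card ≤ m.choose j := by
  induction j, hj using Nat.le_induction with
  | base => exact he
  | succ j hj ih =>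
    have h1 := card_cliqueFinset_succ_mul_le (by omega : 0 < j) hD
    have h2 := Nat.choose_succ_right_eq m j
    refine Nat.le_of_mul_le_mul_right ?_ (Nat.succ_pos j)
    calc _ ≤ _ := h1
      _ ≤ m.choose j * (m - j) := Nat.mul_le_mul_right _ ih
      _ = _ := h2.symm

/-- Joining a clique to a sparse graph creates no more cliques than joining it to a clique with `m`
vertices and isolated vertices. -/
lemma card_cliqueFinset_le_of_off {A : Finset V} {m : ℕ} (hD : ∀ v, (off G A).degree v < m)
    (he : ((off G A).cliqueFinset 2).card ≤ m.choose 2) (r : ℕ)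
    (hm : m + A.card ≤ Fintype.card V) :
    (G.cliqueFinset (r + 1)).card ≤
      (A.card + m).choose (r + 1) + (Fintype.card V - A.card - m) * A.card.choose r := by
  have h1 := card_cliqueFinset_le_sum_mul_choose (G := G) A (r + 1)
  -- Only for `j = 1` can the graph outside `A` have more cliques than a complete graph on `m`
  -- vertices, namely its surplus vertices. The main terms then sum to `(A.card + m).choose (r + 1)`
  -- by Vandermonde's identity.
  have hM : ∀ j, ((G.cliqueFinset j).filter fun Q => Disjoint Q A).card ≤
      m.choose j + if j = 1 then Fintype.card V - A.card - m else 0 := by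
    intro j
    have hsub : ((G.cliqueFinset j).filter fun Q => Disjoint Q A) ⊆ (off G A).cliqueFinset j := by
      intro Q hQ
      rw [Finset.mem_filter, SimpleGraph.mem_cliqueFinset_iff] at hQ
      rw [SimpleGraph.mem_cliqueFinset_iff]
      refine ⟨fun u hu v hv hne => ⟨hQ.1.isClique hu hv hne, ?_, ?_⟩, hQ.1.card_eq⟩
      · exact Finset.disjoint_left.1 hQ.2 hu
      · exact Finset.disjoint_left.1 hQ.2 hv
    rcases Nat.lt_or_ge j 2 with hj | hj
    · have hsub' : ((G.cliqueFinset j).filter fun Q => Disjoint Q A) ⊆ Aᶜ.powersetCard j := by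
        intro Q hQ
        rw [Finset.mem_filter, SimpleGraph.mem_cliqueFinset_iff] at hQ
        rw [Finset.mem_powersetCard]
        exact ⟨fun v hv => Finset.mem_compl.2 (Finset.disjoint_left.1 hQ.2 hv), hQ.1.card_eq⟩
      have := Finset.card_le_card hsub'
      rw [Finset.card_powersetCard, Finset.card_compl] at this
      interval_cases j
      · simpa using this
      · simp only [Nat.choose_one_right, if_true] at this ⊢
        omega
    · exact (Finset.card_le_card hsub).trans ((card_cliqueFinset_le_choose_of_edges hD he j hj).trans
        (Nat.le_add_right _ _))
  refine h1.trans ((Finset.sum_le_sum fun p _ => Nat.mul_le_mul_right _ (hM p.1)).trans ?_)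
  simp only [add_mul, Finset.sum_add_distrib]
  rw [add_comm A.card m, Nat.add_choose_eq]
  refine Nat.add_le_add_left ?_ _
  rw [Finset.sum_eq_single (1, r)]
  · simp
  · rintro ⟨a, b⟩ hab hne
    rw [Finset.HasAntidiagonal.mem_antidiagonal] at hab
    have : a ≠ 1 := by
      rintro rfl
      simp only at hab
      exact hne (by rw [show b = r by omega])
    simp [this]
  · intro h
    exact absurd (Finset.HasAntidiagonal.mem_antidiagonal.2 (add_comm _ _)) h

end

/-! ### Convexity and growth of the extremal numbers -/

/-- A convex sequence that has increased once keeps increasing: either `f` descends all the way from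
`d` to `b`, or it ascends from `b` to `t`. -/
lemma le_max_of_midpoint_convex {f : ℕ → ℕ} {d b t : ℕ} (hdb : d ≤ b) (hbt : b ≤ t)
    (hf : ∀ i, i + 2 ≤ t → 2 * f (i + 1) ≤ f i + f (i + 2)) : f b ≤ max (f d) (f t) := by
  by_cases hanti : ∀ i, d ≤ i → i < b → f (i + 1) ≤ f i
  · refine le_max_of_le_left ?_
    induction b, hdb using Nat.le_induction with
    | base => exact le_rfl
    | succ b hb ih =>
      exact (hanti b hb (Nat.lt_succ_self b)).trans
        (ih (by omega) fun i h1 h2 => hanti i h1 (by omega))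
  · push Not at hanti
    obtain ⟨i, -, hib, hlt⟩ := hanti
    have hinc : ∀ j, i ≤ j → j + 1 ≤ t → f j < f (j + 1) := by
      intro j hij
      induction j, hij using Nat.le_induction with
      | base => exact fun _ => hlt
      | succ j hj ih =>
        intro hjt
        have h1 := ih (by omega)
        have h2 : 2 * f (j + 1) ≤ f j + f (j + 1 + 1) := hf j (by omega)
        omega
    refine le_max_of_le_right ?_
    induction t, hbt using Nat.le_induction with
    | base => exact le_rfl
    | succ t ht ih =>
      exact (ih (fun j h => hf j (by omega)) fun j h1 h2 => hinc j h1 (by omega)).trans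
        (hinc t (by omega) le_rfl).le

/-- By Pascal's rule both summands have non-negative second differences; the second is a product of
non-negative, non-decreasing convex sequences. -/
lemma hCliques_midpoint_convex (q n k b : ℕ) (hb : b + 2 ≤ k) :
    2 * hCliques (q + 2) n k (b + 1) ≤ hCliques (q + 2) n k b + hCliques (q + 2) n k (b + 2) := by
  obtain ⟨K, rfl⟩ := Nat.exists_eq_add_of_le hb
  have e0 : b + 2 + K - b = K + 2 := by omega
  have e1 : b + 2 + K - (b + 1) = K + 1 := by omega
  have e2 : b + 2 + K - (b + 2) = K := by omega
  simp only [hCliques, e0, e1, e2]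
  have c1 : (K + 2).choose (q + 2) = (K + 1).choose (q + 1) + (K + 1).choose (q + 2) := rfl
  have c2 : (K + 1).choose (q + 2) = K.choose (q + 1) + K.choose (q + 2) := rfl
  have c3 : (K + 1).choose (q + 1) = K.choose q + K.choose (q + 1) := rfl
  have d1 : (b + 2).choose (q + 1) = (b + 1).choose q + (b + 1).choose (q + 1) := rfl
  have d2 : (b + 1).choose (q + 1) = b.choose q + b.choose (q + 1) := rfl
  have d3 : b.choose q ≤ (b + 1).choose q := Nat.choose_le_choose _ (Nat.le_succ _)
  rw [c1, c2, c3, d1, d2]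
  rw [show n - (b + 2 + K) + (b + 1) = n - (b + 2 + K) + b + 1 from rfl,
    show n - (b + 2 + K) + (b + 2) = n - (b + 2 + K) + b + 2 from rfl]
  generalize n - (b + 2 + K) + b = M
  nlinarith [Nat.mul_le_mul_left M d3]

lemma hCliques_le_max {q n k d b t : ℕ} (hdb : d ≤ b) (hbt : b ≤ t) (htk : t ≤ k) :
    hCliques (q + 2) n k b ≤ max (hCliques (q + 2) n k d) (hCliques (q + 2) n k t) :=
  le_max_of_midpoint_convex (f := fun b => hCliques (q + 2) n k b) hdb hbt
    fun i hi => hCliques_midpoint_convex q n k i (by omega)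

/-- With `t = u + 1`, the factor `u.choose q` is the increment of `choose · (q + 1)` from `t - 1` to
`t`. Thus an exceptional vertex of degree `t + 2` costs at most a cubic multiple of the gain at an
ordinary vertex. -/
lemma choose_add_three_le {u q : ℕ} (hq : q ≤ u) :
    (u + 3).choose (q + 1) ≤ (u + 3) * (u + 2) * (u + 1) * u.choose q := by
  have h1 : (u + 3).choose (q + 1) ≤ (u + 3) * (u + 2).choose q := by
    rw [show (u + 3) * (u + 2).choose q = (u + 3).choose (q + 1) * (q + 1) from
      Nat.add_one_mul_choose_eq (u + 2) q]
    exact Nat.le_mul_of_pos_right _ (Nat.succ_pos q)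
  have step : ∀ v, q ≤ v → (v + 1).choose q ≤ (v + 1) * v.choose q := by
    intro v hv
    rw [mul_comm, Nat.choose_mul_succ_eq]
    exact Nat.le_mul_of_pos_right _ (by omega)
  calc _ ≤ _ := h1
    _ ≤ (u + 3) * ((u + 2) * ((u + 1) * u.choose q)) :=
      Nat.mul_le_mul_left _ ((step (u + 1) (by omega)).trans
        (Nat.mul_le_mul_left _ (step u hq)))
    _ = _ := by ring

/-- For large `n`, few vertices of degree at most `t + 2` and all others of degree below `t`
span fewer cliques than `H(n, k, t)`. -/
lemma choose_add_le_hCliques {n k q t a w T : ℕ} (hn : k ^ 5 < n) (hkt : 2 * t + 5 ≤ k)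
    (hqt : q + 1 ≤ t) (hat : a < t) (hw : w + t < k) (hT : T ≤ 2 * k * k) :
    w.choose (q + 2) + T * (t + 2).choose (q + 1) + n * a.choose (q + 1) ≤
      hCliques (q + 2) n k t := by
  obtain ⟨u, rfl⟩ : ∃ u, t = u + 1 := ⟨t - 1, by omega⟩
  have h1 : w.choose (q + 2) ≤ (k - (u + 1)).choose (q + 2) := Nat.choose_le_choose _ (by omega)
  have h2 : a.choose (q + 1) ≤ u.choose (q + 1) := Nat.choose_le_choose _ (by omega)
  have h3 := choose_add_three_le (u := u) (q := q) (by omega)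
  have h4 : u.choose (q + 1) ≤ (u + 3).choose (q + 1) := Nat.choose_le_choose _ (by omega)
  have h5 : (u + 1).choose (q + 1) = u.choose q + u.choose (q + 1) := rfl
  -- Since `2 * (u + 3) ≤ k`, the cubic factor is at most `k³ / 8`, and `k ^ 5` absorbs its product
  -- with `2k² + k`: at most `2k²` exceptional vertices, and `k` more because `hCliques` has `n - k`
  -- in place of `n`.
  have h6 : (2 * k * k + k) * ((u + 3) * (u + 2) * (u + 1)) + k ≤ n := by
    have hb : 8 * ((u + 3) * (u + 2) * (u + 1)) ≤ k * k * k := by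
      calc 8 * ((u + 3) * (u + 2) * (u + 1)) =
          (2 * (u + 3)) * (2 * (u + 2)) * (2 * (u + 1)) := by ring
        _ ≤ k * k * k := by gcongr <;> omega
    have hk : 7 ≤ k := by omega
    have h1' : 8 * ((2 * k * k + k) * ((u + 3) * (u + 2) * (u + 1))) ≤
        (2 * k * k + k) * (k * k * k) := by
      calc _ = (2 * k * k + k) * (8 * ((u + 3) * (u + 2) * (u + 1))) := by ring
        _ ≤ _ := Nat.mul_le_mul_left _ hb
    have h2' : (2 * k * k + k) * (k * k * k) + 8 * k ≤ 8 * k ^ 5 := by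
      have e1 : k * k * k * k ≤ k ^ 5 := by
        rw [show k ^ 5 = k * k * k * k * k by ring]; exact Nat.le_mul_of_pos_right _ (by omega)
      have e2 : k ≤ k * k * k * k := by
        rw [show k * k * k * k = k * (k * k * k) by ring]
        exact Nat.le_mul_of_pos_right _ (by positivity)
      nlinarith
    omega
  have hT' : T * (u + 3).choose (q + 1) + k * u.choose (q + 1) ≤ (n - k) * u.choose q := by
    calc T * (u + 3).choose (q + 1) + k * u.choose (q + 1)
        ≤ 2 * k * k * (u + 3).choose (q + 1) + k * (u + 3).choose (q + 1) := by gcongr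
      _ = (2 * k * k + k) * (u + 3).choose (q + 1) := by ring
      _ ≤ (2 * k * k + k) * ((u + 3) * (u + 2) * (u + 1) * u.choose q) := by gcongr
      _ = (2 * k * k + k) * ((u + 3) * (u + 2) * (u + 1)) * u.choose q := by ring
      _ ≤ _ := Nat.mul_le_mul_right _ (by omega)
  have hnk : k ≤ n := by omega
  obtain ⟨N, rfl⟩ := Nat.exists_eq_add_of_le hnk
  simp only [hCliques, Nat.add_sub_cancel_left] at hT' ⊢
  rw [h5]
  have h7 : (k + N) * a.choose (q + 1) ≤ (k + N) * u.choose (q + 1) := Nat.mul_le_mul_left _ h2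
  rw [show u + 1 + 2 = u + 3 by ring]
  nlinarith

/-! ### Path covers and the number of edges -/

/-- A partition of the vertices into paths. -/
structure IsPathCover (G : SimpleGraph V) (P : List (List V)) : Prop where
  path : ∀ p ∈ P, links G p + 1 = p.length
  nodup : P.flatten.Nodup
  mem : ∀ v, v ∈ P.flatten

lemma exists_isPathCover [Fintype V] : ∃ P, IsPathCover G P := by
  have h : ((Finset.univ : Finset V).toList.map fun v => [v]).flatten =
      (Finset.univ : Finset V).toList := by
    induction (Finset.univ : Finset V).toList with
    | nil => rfl
    | cons a l ih => simp [ih]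
  refine ⟨(Finset.univ : Finset V).toList.map fun v => [v], ?_, ?_, ?_⟩
  · intro p hp
    obtain ⟨v, -, rfl⟩ := List.mem_map.1 hp
    rfl
  · rw [h]; exact Finset.nodup_toList _
  · rw [h]; simp

lemma sum_links_le_links_flatten (P : List (List V)) :
    (P.map (links G)).sum ≤ links G P.flatten := by
  induction P with
  | nil => simp
  | cons p P ih =>
    rw [List.flatten_cons, List.map_cons, List.sum_cons]
    exact (Nat.add_le_add_left ih _).trans (links_add_le_links_append _ _)

/-- `v` is the first or the last element of `p`. -/
def IsEnd (p : List V) (v : V) : Prop := p.head? = some v ∨ p.getLast? = some v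

lemma mem_tail_dropLast_or_isEnd {p : List V} {v : V} (hv : v ∈ p) :
    v ∈ p.tail.dropLast ∨ IsEnd p v := by
  cases p with
  | nil => simp at hv
  | cons a p =>
    rcases List.eq_nil_or_concat p with rfl | ⟨p, b, rfl⟩
    · simp at hv
      simp [IsEnd, hv]
    · simp only [List.concat_eq_append, List.mem_cons, List.mem_append, List.not_mem_nil,
        or_false] at hv
      rcases hv with rfl | hv | rfl
      · exact Or.inr (Or.inl rfl)
      · exact Or.inl (by simpa using hv)
      · exact Or.inr (Or.inr (by
          rw [List.concat_eq_append, ← List.cons_append, List.getLast?_concat]))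

lemma IsEnd.exists_perm_getLast {p : List V} {v : V} (h : IsEnd p v) :
    ∃ p' : List V, p'.Perm p ∧ links G p' = links G p ∧ p'.getLast? = some v := by
  rcases h with h | h
  · exact ⟨p.reverse, List.reverse_perm p, links_reverse p, by simpa using h⟩
  · exact ⟨p, List.Perm.refl p, rfl, h⟩

/-- The two paths are oriented and glued along `u v`. Hence in a smallest cover no edge joins ends
of different paths. -/
lemma IsPathCover.exists_shorter [DecidableEq V] {P : List (List V)} (hP : IsPathCover G P)
    {p q : List V} (hp : p ∈ P) (hq : q ∈ P) (hpq : p ≠ q) {u v : V} (hu : IsEnd p u)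
    (hv : IsEnd q v) (huv : G.Adj u v) : ∃ P', IsPathCover G P' ∧ P'.length < P.length := by
  obtain ⟨p', hp1, hp2, hp3⟩ := hu.exists_perm_getLast (G := G)
  obtain ⟨q', hq1, hq2, hq3⟩ := hv.exists_perm_getLast (G := G)
  have hqe : q ∈ P.erase p := (List.mem_erase_of_ne hpq.symm).2 hq
  set R := (P.erase p).erase q with hR
  have hperm : P.Perm (p :: q :: R) :=
    (List.perm_cons_erase hp).trans ((List.perm_cons_erase hqe).cons p)
  have hflat : ((p' ++ q'.reverse) :: R).flatten.Perm P.flatten := by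
    refine List.Perm.trans ?_ hperm.flatten.symm
    simp only [List.flatten_cons, ← List.append_assoc]
    exact ((hp1.append ((List.reverse_perm q').trans hq1)).append_right _)
  refine ⟨(p' ++ q'.reverse) :: R, ⟨?_, hflat.nodup_iff.2 hP.nodup,
    fun w => hflat.mem_iff.2 (hP.mem w)⟩, ?_⟩
  · intro s hs
    rcases List.mem_cons.1 hs with rfl | hs
    · have h1 := links_append_of_adj (G := G) (B := q'.reverse) (b := v) hp3 (by simpa using hq3) huv
      have h2 := hP.path p hp
      have h3 := hP.path q hq
      rw [links_reverse] at h1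
      rw [List.length_append, List.length_reverse, hp1.length_eq, hq1.length_eq]
      omega
    · exact hP.path s (List.mem_of_mem_erase (List.mem_of_mem_erase hs))
  · rw [hperm.length_eq]; simp

lemma exists_two_neighbors_of_mem_tail_dropLast {p : List V} (hp : links G p + 1 = p.length)
    (hnd : p.Nodup) {v : V} (hv : v ∈ p.tail.dropLast) :
    ∃ a b, a ≠ b ∧ G.Adj v a ∧ G.Adj v b := by
  cases p with
  | nil => simp at hv
  | cons a p =>
    obtain ⟨l1, l2, hl⟩ := List.append_of_mem hv
    rcases List.eq_nil_or_concat p with rfl | ⟨p, z, rfl⟩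
    · simp at hv
    simp only [List.concat_eq_append, List.tail_cons, List.dropLast_concat] at hl
    subst hl
    obtain ⟨b, l3, hb⟩ : ∃ b l3, l2 ++ [z] = b :: l3 := by
      cases l2 <;> simp
    obtain ⟨l0, c, hc⟩ : ∃ l0 c, a :: l1 = l0 ++ [c] := by
      rcases List.eq_nil_or_concat l1 with rfl | ⟨l, c, rfl⟩
      · exact ⟨[], a, rfl⟩
      · exact ⟨a :: l, c, by simp⟩
    have e : a :: ((l1 ++ v :: l2).concat z) = l0 ++ c :: v :: b :: l3 := by
      have : a :: ((l1 ++ v :: l2).concat z) = (a :: l1) ++ v :: (l2 ++ [z]) := by simp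
      rw [this, hc, hb]; simp
    rw [e] at hp hnd
    have h1 := links_append (G := G) l0 c v (b :: l3)
    rw [links_cons_cons v b] at h1
    have h2 := links_lt_length (G := G) (l := l0 ++ [c]) (by simp)
    have h3 := links_lt_length (G := G) (l := b :: l3) (by simp)
    simp only [List.length_append, List.length_cons, List.length_nil] at hp h2 h3
    refine ⟨c, b, ?_, ?_, ?_⟩
    · rintro rfl
      simp [List.nodup_append] at hnd
    · by_contra hn
      rw [if_neg (fun h => hn h.symm)] at h1
      split_ifs at h1 <;> omega
    · by_contra hn
      rw [if_neg hn] at h1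
      split_ifs at h1 <;> omega

section

variable [Fintype V]

open scoped Classical

lemma card_edges_le_of_forall_mem {S : Finset V} (h : ∀ u v, G.Adj u v → u ∈ S) :
    (G.cliqueFinset 2).card ≤ S.card.choose 2 := by
  rw [← Finset.card_powersetCard]
  refine Finset.card_le_card fun Q hQ => ?_
  rw [SimpleGraph.mem_cliqueFinset_iff] at hQ
  obtain ⟨u, v, hne, rfl⟩ := Finset.card_eq_two.1 hQ.card_eq
  have huv : G.Adj u v := hQ.isClique (by simp) (by simp) hne
  rw [Finset.mem_powersetCard]
  refine ⟨?_, hQ.card_eq⟩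
  rw [Finset.insert_subset_iff, Finset.singleton_subset_iff]
  exact ⟨h _ _ huv, h _ _ huv.symm⟩

/-- A smallest path cover yields a set `M` of vertices of degree at least two that covers all but
`c` edges. -/
lemma LinksLT.exists_cover {m : ℕ} (h : LinksLT G m) (hm : 2 ≤ m) :
    ∃ (M : Finset V) (c : ℕ), M.card + c < m ∧ M.card + 2 ≤ m ∧ (∀ v ∈ M, 2 ≤ G.degree v) ∧
      ∃ B : Finset (Finset V), B.card ≤ c ∧
        ∀ u v, G.Adj u v → u ∈ M ∨ v ∈ M ∨ ({u, v} : Finset V) ∈ B := by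
  have hex : ∃ N, ∃ P, IsPathCover G P ∧ P.length = N := by
    obtain ⟨P, hP⟩ := exists_isPathCover (G := G)
    exact ⟨_, P, hP, rfl⟩
  obtain ⟨P, hP, hlen⟩ := Nat.find_spec hex
  have hmin : ∀ P', IsPathCover G P' → P.length ≤ P'.length := fun P' hP' => by
    rw [hlen]; exact Nat.find_min' hex ⟨P', hP', rfl⟩
  have hnd : ∀ p ∈ P, p.Nodup := (List.nodup_flatten.1 hP.nodup).1
  -- `M` collects the inner vertices, `E` the paths with at least one edge, `B` the pairs of ends of
  -- those paths. Each path in `E` has one link more than it has inner vertices, so `|M| + |E|` is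
  -- at most the total number of links.
  set M : Finset V := (P.map fun p => p.tail.dropLast).flatten.toFinset with hM
  set E : List (List V) := P.filter fun p => 2 ≤ p.length with hE
  set B : Finset (Finset V) := (E.map fun p => (p.head?.toList ++ p.getLast?.toList).toFinset).toFinset
    with hB
  have hsum : ∀ P : List (List V), (∀ p ∈ P, links G p + 1 = p.length) →
      (P.map fun p => p.tail.dropLast).flatten.length + (P.filter fun p => 2 ≤ p.length).length =
        (P.map (links G)).sum := by
    intro P hP
    induction P with
    | nil => rfl
    | cons p P ih =>
      have h1 := ih fun q hq => hP q (List.mem_cons_of_mem _ hq)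
      have h2 := hP p List.mem_cons_self
      by_cases hp : 2 ≤ p.length
      · rw [List.filter_cons_of_pos (by simpa using hp)]
        simp only [List.map_cons, List.flatten_cons, List.length_append, List.length_dropLast,
          List.length_tail, List.length_cons, List.sum_cons] at h1 ⊢
        omega
      · rw [List.filter_cons_of_neg (by simpa using hp)]
        simp only [List.map_cons, List.flatten_cons, List.length_append, List.length_dropLast,
          List.length_tail, List.sum_cons] at h1 ⊢
        omega
  have hlt := h _ hP.nodup
  have hle := sum_links_le_links_flatten (G := G) P
  have hMle : M.card ≤ (P.map fun p => p.tail.dropLast).flatten.length := List.toFinset_card_le _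
  have hs := hsum P hP.path
  rw [← hE] at hs
  refine ⟨M, E.length, by omega, ?_, ?_, B, ?_, ?_⟩
  · rcases Nat.eq_zero_or_pos M.card with h0 | h0
    · omega
    · obtain ⟨v, hv⟩ := Finset.card_pos.1 h0
      rw [hM, List.mem_toFinset, List.mem_flatten] at hv
      obtain ⟨l, hl, hvl⟩ := hv
      obtain ⟨p, hp, rfl⟩ := List.mem_map.1 hl
      have : 0 < p.tail.dropLast.length := List.length_pos_of_mem hvl
      rw [List.length_dropLast, List.length_tail] at this
      have : 0 < E.length := List.length_pos_of_mem (a := p)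
        (List.mem_filter.2 ⟨hp, by simp; omega⟩)
      omega
  · intro v hv
    rw [hM, List.mem_toFinset, List.mem_flatten] at hv
    obtain ⟨l, hl, hvl⟩ := hv
    obtain ⟨p, hp, rfl⟩ := List.mem_map.1 hl
    obtain ⟨a, b, hab, ha, hb⟩ :=
      exists_two_neighbors_of_mem_tail_dropLast (hP.path p hp) (hnd p hp) hvl
    rw [← SimpleGraph.card_neighborFinset_eq_degree, ← Finset.card_pair hab]
    refine Finset.card_le_card ?_
    rw [Finset.insert_subset_iff, Finset.singleton_subset_iff]
    simp [ha, hb]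
  · exact (List.toFinset_card_le _).trans (by simp)
  · intro u v huv
    obtain ⟨p, hp, hup⟩ := List.mem_flatten.1 (hP.mem u)
    obtain ⟨q, hq, hvq⟩ := List.mem_flatten.1 (hP.mem v)
    have hmem : ∀ p ∈ P, ∀ w ∈ p.tail.dropLast, w ∈ M := fun p hp w hw => by
      rw [hM, List.mem_toFinset, List.mem_flatten]
      exact ⟨_, List.mem_map.2 ⟨p, hp, rfl⟩, hw⟩
    rcases mem_tail_dropLast_or_isEnd hup with h1 | h1
    · exact Or.inl (hmem p hp u h1)
    rcases mem_tail_dropLast_or_isEnd hvq with h2 | h2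
    · exact Or.inr (Or.inl (hmem q hq v h2))
    right; right
    by_cases hpq : p = q
    · subst hpq
      have hne := huv.ne
      rw [hB, List.mem_toFinset, List.mem_map]
      refine ⟨p, List.mem_filter.2 ⟨hp, ?_⟩, ?_⟩
      · rcases p with _ | ⟨a, _ | ⟨b, p⟩⟩
        · simp at hup
        · simp at hup hvq
          exact absurd (hup.trans hvq.symm) hne
        · simp
      · rcases h1 with h1 | h1 <;> rcases h2 with h2 | h2
        · exact absurd (Option.some.inj (h1.symm.trans h2)) hne
        · rw [h1, h2]; ext; simp
        · rw [h1, h2]; ext; simp [or_comm]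
        · exact absurd (Option.some.inj (h1.symm.trans h2)) hne
    · obtain ⟨P', hP', hlt'⟩ := hP.exists_shorter hp hq hpq h1 h2 huv
      exact absurd (hmin P' hP') (not_le.2 hlt')

/-- Each edge outside `B` is charged to an end in `M`. The choice of `f` makes it possible not to
charge an edge at both ends. -/
lemma card_edges_le_add_sum {M : Finset V} {B : Finset (Finset V)} (f : V → Finset V)
    (h : ∀ u v, G.Adj u v → (u ∈ M ∧ v ∈ f u) ∨ (v ∈ M ∧ u ∈ f v) ∨ ({u, v} : Finset V) ∈ B) :
    (G.cliqueFinset 2).card ≤ B.card + ∑ v ∈ M, (f v).card := by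
  have hsub : G.cliqueFinset 2 ⊆ B ∪ M.biUnion fun u => (f u).image fun v => {u, v} := by
    intro Q hQ
    rw [SimpleGraph.mem_cliqueFinset_iff] at hQ
    obtain ⟨u, v, hne, rfl⟩ := Finset.card_eq_two.1 hQ.card_eq
    have huv : G.Adj u v := hQ.isClique (by simp) (by simp) hne
    rw [Finset.mem_union, Finset.mem_biUnion]
    rcases h u v huv with h | h | h
    · exact Or.inr ⟨u, h.1, Finset.mem_image.2 ⟨v, h.2, rfl⟩⟩
    · exact Or.inr ⟨v, h.1, Finset.mem_image.2 ⟨u, h.2, Finset.pair_comm _ _⟩⟩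
    · exact Or.inl h
  refine (Finset.card_le_card hsub).trans ((Finset.card_union_le _ _).trans
    (Nat.add_le_add_left (Finset.card_biUnion_le.trans ?_) _))
  exact Finset.sum_le_sum fun u _ => Finset.card_image_le

/-- A closed graph without linear forests of size `m ∈ {5, 6}` has at most as many edges as a
complete graph on `m` vertices. -/
lemma LinksLT.card_edges_le {m : ℕ} (h : LinksLT G m) (hm : m = 5 ∨ m = 6)
    (hdeg : ∀ v, G.degree v < m)
    (hclosed : ∀ u v, u ≠ v → ¬ G.Adj u v → G.degree u + G.degree v < m) :
    (G.cliqueFinset 2).card ≤ m.choose 2 := by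
  -- By closedness, a vertex of degree `m - 1` is adjacent to all other non-isolated vertices, so
  -- every edge lies in its closed neighbourhood.
  by_cases hx : ∃ x, G.degree x + 1 = m
  · obtain ⟨x, hx⟩ := hx
    have hcard : (insert x (G.neighborFinset x)).card = m := by
      rw [Finset.card_insert_of_notMem (by simp), SimpleGraph.card_neighborFinset_eq_degree, hx]
    rw [← hcard]
    refine card_edges_le_of_forall_mem fun u v huv => ?_
    rw [Finset.mem_insert, SimpleGraph.mem_neighborFinset]
    by_contra hn
    rw [not_or] at hn
    have h1 := hclosed u x hn.1 fun h => hn.2 h.symm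
    have h2 : 0 < G.degree u := (G.degree_pos_iff_exists_adj u).2 ⟨v, huv⟩
    omega
  · push Not at hx
    obtain ⟨M, c, h1, h2, h3, B, hB, hcov⟩ := h.exists_cover (by omega)
    -- If all degrees in `M` are at most 3, there are at most `c + 3|M| ≤ (m - 1) + 2(m - 2) = 3m -
    -- 5` edges. A vertex of degree 4, possible only for `m = 6`, adds one.
    have hchoose : 3 * m ≤ m.choose 2 + 5 ∧ (m = 6 → 3 * m ≤ m.choose 2 + 4) := by
      rcases hm with rfl | rfl <;> decide
    by_cases hM : ∃ x ∈ M, 4 ≤ G.degree x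
    · obtain ⟨x, hxM, hx4⟩ := hM
      have hx' := hx x
      have hd := hdeg x
      have hm6 : m = 6 := by omega
      -- Degrees 2 and 4 already add up to 6, so `x` is adjacent to the rest of `M`. Charging those
      -- edges to `x` leaves at most 3 for every other vertex.
      have hadj : ∀ v ∈ M, v ≠ x → G.Adj v x := by
        intro v hv hne
        by_contra hn
        have := hclosed v x hne hn
        have := h3 v hv
        omega
      have hle := card_edges_le_add_sum (G := G) (M := M) (B := B)
        (fun v => if v = x then G.neighborFinset v else (G.neighborFinset v).erase x) ?_
      · rw [← Finset.add_sum_erase _ _ hxM, if_pos rfl] at hle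
        have hs : ∑ v ∈ M.erase x, (if v = x then G.neighborFinset v else
            (G.neighborFinset v).erase x).card ≤ (M.erase x).card * 3 := by
          rw [← smul_eq_mul]
          refine Finset.sum_le_card_nsmul _ _ _ fun v hv => ?_
          have hne := Finset.ne_of_mem_erase hv
          rw [if_neg hne, Finset.card_erase_of_mem (by
            simpa using hadj v (Finset.mem_of_mem_erase hv) hne),
            SimpleGraph.card_neighborFinset_eq_degree]
          have := hx v
          have := hdeg v
          omega
        rw [Finset.card_erase_of_mem hxM] at hs
        rw [SimpleGraph.card_neighborFinset_eq_degree] at hle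
        have := Finset.card_pos.2 ⟨x, hxM⟩
        omega
      · intro u v huv
        by_cases hux : u = x
        · left; rw [if_pos hux, SimpleGraph.mem_neighborFinset]; exact ⟨hux ▸ hxM, huv⟩
        by_cases hvx : v = x
        · right; left; rw [if_pos hvx, SimpleGraph.mem_neighborFinset]
          exact ⟨hvx ▸ hxM, huv.symm⟩
        rw [if_neg hux, if_neg hvx, Finset.mem_erase, Finset.mem_erase,
          SimpleGraph.mem_neighborFinset, SimpleGraph.mem_neighborFinset]
        rcases hcov u v huv with h | h | h
        · exact Or.inl ⟨h, hvx, huv⟩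
        · exact Or.inr (Or.inl ⟨h, hux, huv.symm⟩)
        · exact Or.inr (Or.inr h)
    · push Not at hM
      have hle := card_edges_le_add_sum (G := G) (M := M) (B := B) (fun v => G.neighborFinset v)
        fun u v huv => by
          rw [SimpleGraph.mem_neighborFinset, SimpleGraph.mem_neighborFinset]
          rcases hcov u v huv with h | h | h
          · exact Or.inl ⟨h, huv⟩
          · exact Or.inr (Or.inl ⟨h, huv.symm⟩)
          · exact Or.inr (Or.inr h)
      have hs : ∑ v ∈ M, (G.neighborFinset v).card ≤ M.card * 3 := by
        rw [← smul_eq_mul]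
        refine Finset.sum_le_card_nsmul _ _ _ fun v hv => ?_
        rw [SimpleGraph.card_neighborFinset_eq_degree]
        have := hM v hv
        omega
      omega

end

/-! ### Structure of closed graphs without linear forests of size three or four -/

section

variable [Fintype V]

open scoped Classical

lemma two_le_degree {v a b : V} (ha : G.Adj v a) (hb : G.Adj v b) (hab : a ≠ b) :
    2 ≤ G.degree v := by
  rw [← SimpleGraph.card_neighborFinset_eq_degree, ← Finset.card_pair hab]
  refine Finset.card_le_card ?_
  simp [Finset.insert_subset_iff, ha, hb]

lemma three_le_degree {v a b c : V} (ha : G.Adj v a) (hb : G.Adj v b) (hc : G.Adj v c)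
    (hab : a ≠ b) (hac : a ≠ c) (hbc : b ≠ c) : 3 ≤ G.degree v := by
  have h3 : ({a, b, c} : Finset V).card = 3 := Finset.card_eq_three.2 ⟨a, b, c, hab, hac, hbc, rfl⟩
  rw [← SimpleGraph.card_neighborFinset_eq_degree, ← h3]
  refine Finset.card_le_card ?_
  simp [Finset.insert_subset_iff, ha, hb, hc]

lemma eq_of_adj_of_degree_le_one {v a b : V} (hv : G.degree v ≤ 1) (ha : G.Adj v a)
    (hb : G.Adj v b) : a = b := by
  by_contra hab
  have := two_le_degree ha hb hab
  omega

/-- More non-isolated vertices than `S` has elements yield an edge leaving `S`. -/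
lemma exists_adj_notMem {S : Finset V} (hS : S.card < (nonIsolated G).card) :
    ∃ u v, G.Adj u v ∧ u ∉ S := by
  obtain ⟨u, hu, huS⟩ := Finset.exists_mem_notMem_of_card_lt_card hS
  obtain ⟨v, hv⟩ := mem_nonIsolated.1 hu
  exact ⟨u, v, hv, huS⟩

/-- All edges of `G` lie in `S`, apart from the edge `p q` outside `S`. -/
structure IsCliquePlusEdge (G : SimpleGraph V) (S : Finset V) (p q : V) : Prop where
  adj : G.Adj p q
  left_notMem : p ∉ S
  right_notMem : q ∉ S
  cover : ∀ u v, G.Adj u v → (u ∈ S ∧ v ∈ S) ∨ (u = p ∧ v = q) ∨ (u = q ∧ v = p)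

/-- All edges of `G` lie in `S`, apart from the disjoint edges `p q` and `x y` outside `S`. -/
structure IsCliquePlusTwoEdges (G : SimpleGraph V) (S : Finset V) (p q x y : V) : Prop where
  adj_left : G.Adj p q
  adj_right : G.Adj x y
  notMem : p ∉ S ∧ q ∉ S ∧ x ∉ S ∧ y ∉ S
  disjoint : p ≠ x ∧ p ≠ y ∧ q ≠ x ∧ q ≠ y
  cover : ∀ u v, G.Adj u v → (u ∈ S ∧ v ∈ S) ∨ (u = p ∧ v = q) ∨ (u = q ∧ v = p) ∨
    (u = x ∧ v = y) ∨ (u = y ∧ v = x)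

lemma card_nonIsolated_le_of_degree {m : ℕ}
    (hclosed : ∀ u v, u ≠ v → ¬ G.Adj u v → G.degree u + G.degree v < m) {x : V}
    (hx : G.degree x + 1 = m) : (nonIsolated G).card ≤ m := by
  have hcard : (insert x (G.neighborFinset x)).card = m := by
    rw [Finset.card_insert_of_notMem (by simp), SimpleGraph.card_neighborFinset_eq_degree, hx]
  rw [← hcard]
  refine Finset.card_le_card fun u hu => ?_
  obtain ⟨v, huv⟩ := mem_nonIsolated.1 hu
  rw [Finset.mem_insert, SimpleGraph.mem_neighborFinset]
  by_contra hn
  rw [not_or] at hn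
  have h1 := hclosed u x hn.1 fun h => hn.2 h.symm
  have h2 : 0 < G.degree u := (G.degree_pos_iff_exists_adj u).2 ⟨v, huv⟩
  omega

/-- Two disjoint edges in a graph of maximum degree one. -/
lemma exists_two_edges (hdeg : ∀ v, G.degree v ≤ 1) (h : 2 < (nonIsolated G).card) :
    ∃ u v p q, G.Adj u v ∧ G.Adj p q ∧ u ≠ p ∧ u ≠ q ∧ v ≠ p ∧ v ≠ q := by
  obtain ⟨u, v, huv, -⟩ := exists_adj_notMem (G := G) (S := ∅) (by
    rw [Finset.card_empty]; omega)
  obtain ⟨p, q, hpq, hp⟩ := exists_adj_notMem (G := G) (S := {u, v})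
    ((Finset.card_le_two).trans_lt h)
  simp only [Finset.mem_insert, Finset.mem_singleton, not_or] at hp
  refine ⟨u, v, p, q, huv, hpq, Ne.symm hp.1, ?_, Ne.symm hp.2, ?_⟩
  · rintro rfl
    exact hp.2 (eq_of_adj_of_degree_le_one (hdeg _) hpq.symm huv)
  · rintro rfl
    exact hp.1 (eq_of_adj_of_degree_le_one (hdeg _) hpq.symm huv.symm)

/-- A vertex of degree 2 gathers all non-isolated vertices in its closed neighbourhood. Otherwise
the edges form a matching, and three of them would be three links. -/
lemma LinksLT.structure_three (h : LinksLT G 3) (hdeg : ∀ v, G.degree v < 3)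
    (hclosed : ∀ u v, u ≠ v → ¬ G.Adj u v → G.degree u + G.degree v < 3) :
    (nonIsolated G).card ≤ 3 ∨ ∃ S p q, S.card ≤ 2 ∧ IsCliquePlusEdge G S p q := by
  by_cases hT : (nonIsolated G).card ≤ 3
  · exact Or.inl hT
  right
  have hdeg1 : ∀ v, G.degree v ≤ 1 := by
    intro v
    by_contra hn
    have := hdeg v
    exact hT (card_nonIsolated_le_of_degree hclosed (x := v) (by omega))
  obtain ⟨u, v, p, q, huv, hpq, h1, h2, h3, h4⟩ := exists_two_edges hdeg1 (by omega)
  refine ⟨{u, v}, p, q, Finset.card_le_two, hpq, by simp [h1.symm, h3.symm],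
    by simp [h2.symm, h4.symm], fun a b hab => ?_⟩
  have key : ∀ x y z w, G.Adj x y → G.Adj z w → x = z → y = w := by
    rintro x y z w hxy hzw rfl
    exact eq_of_adj_of_degree_le_one (hdeg1 x) hxy hzw
  by_contra hn
  simp only [Finset.mem_insert, Finset.mem_singleton] at hn
  have e1 := key _ _ _ _ hab huv
  have e2 := key _ _ _ _ hab huv.symm
  have e3 := key _ _ _ _ hab hpq
  have e4 := key _ _ _ _ hab hpq.symm
  have f1 := key _ _ _ _ hab.symm huv
  have f2 := key _ _ _ _ hab.symm huv.symm
  have f3 := key _ _ _ _ hab.symm hpq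
  have f4 := key _ _ _ _ hab.symm hpq.symm
  have hl := h [u, v, p, q, a, b] (by
    have := huv.ne; have := hpq.ne; have := hab.ne
    simp only [List.nodup_cons, List.mem_cons, List.not_mem_nil, or_false]
    grind)
  simp only [links_cons_cons, if_pos huv, if_pos hpq, if_pos hab] at hl
  omega

lemma LinksLT.structure_four_of_degree_le_one (h : LinksLT G 4) (hdeg1 : ∀ v, G.degree v ≤ 1)
    (hT : 4 < (nonIsolated G).card) :
    ∃ S p q x y, S.card ≤ 2 ∧ IsCliquePlusTwoEdges G S p q x y := by
  have key : ∀ x y z w, G.Adj x y → G.Adj z w → x = z → y = w := by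
    rintro x y z w hxy hzw rfl
    exact eq_of_adj_of_degree_le_one (hdeg1 x) hxy hzw
  obtain ⟨u, v, p, q, huv, hpq, h1, h2, h3, h4⟩ := exists_two_edges hdeg1 (by omega)
  obtain ⟨x, y, hxy, hx⟩ := exists_adj_notMem (G := G) (S := {u, v, p, q})
    ((Finset.card_le_four).trans_lt hT)
  simp only [Finset.mem_insert, Finset.mem_singleton, not_or] at hx
  have g1 := key _ _ _ _ hxy.symm huv
  have g2 := key _ _ _ _ hxy.symm huv.symm
  have g3 := key _ _ _ _ hxy.symm hpq
  have g4 := key _ _ _ _ hxy.symm hpq.symm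
  refine ⟨{u, v}, p, q, x, y, Finset.card_le_two, hpq, hxy, ?_, ?_, fun a b hab => ?_⟩
  · simp only [Finset.mem_insert, Finset.mem_singleton]
    grind
  · grind
  by_contra hn
  simp only [Finset.mem_insert, Finset.mem_singleton] at hn
  have e1 := key _ _ _ _ hab huv
  have e2 := key _ _ _ _ hab huv.symm
  have e3 := key _ _ _ _ hab hpq
  have e4 := key _ _ _ _ hab hpq.symm
  have e5 := key _ _ _ _ hab hxy
  have e6 := key _ _ _ _ hab hxy.symm
  have f1 := key _ _ _ _ hab.symm huv
  have f2 := key _ _ _ _ hab.symm huv.symm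
  have f3 := key _ _ _ _ hab.symm hpq
  have f4 := key _ _ _ _ hab.symm hpq.symm
  have f5 := key _ _ _ _ hab.symm hxy
  have f6 := key _ _ _ _ hab.symm hxy.symm
  have hl := h [u, v, p, q, x, y, a, b] (by
    have := huv.ne; have := hpq.ne; have := hab.ne; have := hxy.ne
    simp only [List.nodup_cons, List.mem_cons, List.not_mem_nil, or_false, not_or, List.nodup_nil,
      not_false_eq_true, and_true]
    and_intros <;> grind)
  simp only [links_cons_cons, if_pos huv, if_pos hpq, if_pos hab, if_pos hxy] at hl
  omega

/-- A vertex of degree 3 leaves four non-isolated vertices, and maximum degree 1 leaves a matching.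
In between, the closed neighbourhood `{x, y, z}` of a vertex of degree 2 is cut off from the rest,
which consists of a single edge, since a path with two edges and two more disjoint edges would be
four links. -/
lemma LinksLT.structure_four (h : LinksLT G 4) (hdeg : ∀ v, G.degree v < 4)
    (hclosed : ∀ u v, u ≠ v → ¬ G.Adj u v → G.degree u + G.degree v < 4) :
    (nonIsolated G).card ≤ 4 ∨ (∃ S p q, S.card ≤ 3 ∧ IsCliquePlusEdge G S p q) ∨
      ∃ S p q x y, S.card ≤ 2 ∧ IsCliquePlusTwoEdges G S p q x y := by
  by_cases hT : (nonIsolated G).card ≤ 4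
  · exact Or.inl hT
  right
  have hdeg2 : ∀ v, G.degree v ≤ 2 := by
    intro v
    by_contra hn
    have := hdeg v
    exact hT (card_nonIsolated_le_of_degree hclosed (x := v) (by omega))
  by_cases hdeg1 : ∀ v, G.degree v ≤ 1
  · exact Or.inr (h.structure_four_of_degree_le_one hdeg1 (by omega))
  left
  push Not at hdeg1
  obtain ⟨x, hx⟩ := hdeg1
  have hx2 : (G.neighborFinset x).card = 2 := by
    rw [SimpleGraph.card_neighborFinset_eq_degree]
    have := hdeg2 x
    omega
  obtain ⟨y, z, hyz, hN⟩ := Finset.card_eq_two.1 hx2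
  have hNx : ∀ w, G.Adj x w ↔ w = y ∨ w = z := by
    intro w
    rw [← SimpleGraph.mem_neighborFinset, hN]
    simp
  have hxy : G.Adj x y := (hNx y).2 (Or.inl rfl)
  have hxz : G.Adj x z := (hNx z).2 (Or.inr rfl)
  have hout : ∀ w, w ≠ x → w ≠ y → w ≠ z → G.degree w ≤ 1 := by
    intro w h1 h2 h3
    have := hclosed w x h1 fun h => by
      rcases (hNx w).1 h.symm with h | h
      · exact h2 h
      · exact h3 h
    omega
  have hout' : ∀ w a b, w ≠ x → w ≠ y → w ≠ z → G.Adj w a → G.Adj w b → a = b :=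
    fun w a b h1 h2 h3 => eq_of_adj_of_degree_le_one (hout w h1 h2 h3)
  -- If `y` had an outer neighbour `w`, an edge at a fifth non-isolated vertex would either prolong
  -- the path `w y x z` or be disjoint from it: four links in both cases. Stated for all `y z`, so
  -- that it also serves with the two exchanged.
  have hno : ∀ y z, y ≠ z → (∀ w, G.Adj x w ↔ w = y ∨ w = z) → ∀ w, w ≠ x → w ≠ y → w ≠ z →
      ¬ G.Adj y w := by
    intro y z hyz hNx w hwx hwy hwz hyw
    have hxy : G.Adj x y := (hNx y).2 (Or.inl rfl)
    have hxz : G.Adj x z := (hNx z).2 (Or.inr rfl)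
    have hw1 : G.degree w ≤ 1 := by
      have := hclosed w x hwx fun h => by
        rcases (hNx w).1 h.symm with h | h
        · exact hwy h
        · exact hwz h
      omega
    obtain ⟨t, s, hts, ht⟩ := exists_adj_notMem (G := G) (S := {x, y, z, w})
      ((Finset.card_le_four).trans_lt (by omega))
    simp only [Finset.mem_insert, Finset.mem_singleton, not_or] at ht
    obtain ⟨htx, hty, htz, htw⟩ := ht
    have hsx : s ≠ x := by
      rintro rfl
      rcases (hNx t).1 hts.symm with h | h
      · exact hty h
      · exact htz h
    have hsy : s ≠ y := by
      rintro rfl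
      have := three_le_degree hxy.symm hyw hts.symm hwx.symm (Ne.symm htx) (Ne.symm htw)
      have := hdeg2 s
      omega
    have hsw : s ≠ w := by
      rintro rfl
      exact hty (eq_of_adj_of_degree_le_one hw1 hts.symm hyw.symm)
    have n1 := hxy.ne
    have n2 := hxz.ne
    by_cases hsz : s = z
    · subst hsz
      have hl := h [w, y, x, s, t] (by
        simp only [List.nodup_cons, List.mem_cons, List.not_mem_nil, or_false]
        grind)
      simp only [links_cons_cons, if_pos hyw.symm, if_pos hxy.symm, if_pos hxz,
        if_pos hts.symm] at hl
      omega
    · have n3 := hts.ne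
      have hl := h [w, y, x, z, t, s] (by
        simp only [List.nodup_cons, List.mem_cons, List.not_mem_nil, or_false]
        grind)
      simp only [links_cons_cons, if_pos hyw.symm, if_pos hxy.symm, if_pos hxz,
        if_pos hts] at hl
      omega
  have hNx' : ∀ w, G.Adj x w ↔ w = z ∨ w = y := fun w => (hNx w).trans or_comm
  have hcomp : ∀ u v, G.Adj u v → u ≠ x → u ≠ y → u ≠ z → v ≠ x ∧ v ≠ y ∧ v ≠ z := by
    intro u v huv h1 h2 h3
    refine ⟨?_, ?_, ?_⟩
    · rintro rfl
      rcases (hNx u).1 huv.symm with h | h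
      · exact h2 h
      · exact h3 h
    · rintro rfl
      exact hno v z hyz hNx u h1 h2 h3 huv.symm
    · rintro rfl
      exact hno v y hyz.symm hNx' u h1 h3 h2 huv.symm
  obtain ⟨p, q, hpq, hp⟩ := exists_adj_notMem (G := G) (S := {x, y, z})
    ((Finset.card_le_three).trans_lt (by omega))
  simp only [Finset.mem_insert, Finset.mem_singleton, not_or] at hp
  obtain ⟨hpx, hpy, hpz⟩ := hp
  obtain ⟨hqx, hqy, hqz⟩ := hcomp p q hpq hpx hpy hpz
  refine ⟨{x, y, z}, p, q, Finset.card_le_three, hpq, by simp [hpx, hpy, hpz],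
    by simp [hqx, hqy, hqz], ?_⟩
  have main : ∀ u v, G.Adj u v → u ≠ x → u ≠ y → u ≠ z →
      (u = p ∧ v = q) ∨ (u = q ∧ v = p) := by
    intro u v huv hux huy huz
    obtain ⟨hvx, hvy, hvz⟩ := hcomp u v huv hux huy huz
    by_cases hup : u = p
    · subst hup; exact Or.inl ⟨rfl, hout' _ _ _ hux huy huz huv hpq⟩
    by_cases huq : u = q
    · subst huq; exact Or.inr ⟨rfl, hout' _ _ _ hux huy huz huv hpq.symm⟩
    have hvp : v ≠ p := by
      rintro rfl; exact huq (hout' _ _ _ hvx hvy hvz huv.symm hpq)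
    have hvq : v ≠ q := by
      rintro rfl; exact hup (hout' _ _ _ hvx hvy hvz huv.symm hpq.symm)
    have n1 := hxy.ne
    have n2 := hxz.ne
    have n3 := hpq.ne
    have n4 := huv.ne
    have hl := h [y, x, z, p, q, u, v] (by
      simp only [List.nodup_cons, List.mem_cons, List.not_mem_nil, or_false]
      grind)
    simp only [links_cons_cons, if_pos hxy.symm, if_pos hxz, if_pos hpq, if_pos huv] at hl
    omega
  intro u v huv
  simp only [Finset.mem_insert, Finset.mem_singleton]
  by_cases hu : u = x ∨ u = y ∨ u = z
  · by_cases hv : v = x ∨ v = y ∨ v = z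
    · exact Or.inl ⟨hu, hv⟩
    · simp only [not_or] at hv
      exact Or.inr ((main v u huv.symm hv.1 hv.2.1 hv.2.2).symm.imp And.symm And.symm)
  · simp only [not_or] at hu
    exact Or.inr (main u v huv hu.1 hu.2.1 hu.2.2)

/-! ### Embedding into the extremal graphs -/

/-- A numbering of the vertices that starts with `A`, continues with a set containing `S`, and then
with the list `E`. -/
lemma exists_numbering {A S : Finset V} {E : List V} {b : ℕ} (hE : E.Nodup)
    (hEA : ∀ v ∈ E, v ∉ A) (hES : ∀ v ∈ E, v ∉ S) (hb : A.card + S.card ≤ b)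
    (hbn : b + E.length ≤ Fintype.card V) :
    ∃ φ : V → Fin (Fintype.card V), Function.Injective φ ∧ (∀ v, v ∈ A → (φ v).val < A.card) ∧
      (∀ v, v ∈ S → (φ v).val < b) ∧ ∀ i (hi : i < E.length), (φ E[i]).val = b + i := by
  -- `S \ A` is padded to exactly `b - |A|` vertices so that `E` starts at position `b`; the
  -- numbering is the position in `A`, `S'`, `E`, remainder.
  obtain ⟨S', hSS', hS'E, hcard⟩ := Finset.exists_subsuperset_card_eq
    (s := S \ A) (t := Finset.univ \ (A ∪ E.toFinset)) (n := b - A.card) (by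
      intro v hv
      rw [Finset.mem_sdiff] at hv
      simp only [Finset.mem_sdiff, Finset.mem_univ, Finset.mem_union, List.mem_toFinset, true_and,
        not_or]
      exact ⟨hv.2, fun h => hES v h hv.1⟩)
    ((Finset.card_le_card Finset.sdiff_subset).trans (by omega)) (by
      rw [Finset.card_sdiff_of_subset (Finset.subset_univ _), Finset.card_univ]
      have h1 := Finset.card_union_le A E.toFinset
      have h2 := List.toFinset_card_le E
      omega)
  have hS' : ∀ v ∈ S', v ∉ A ∧ v ∉ E := fun v hv => by
    have := hS'E hv
    simpa [not_or] using this
  set rest := (Finset.univ \ (A ∪ S' ∪ E.toFinset)).toList with hrest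
  set L := (A.toList ++ S'.toList) ++ (E ++ rest) with hL
  have hLnd : L.Nodup := by
    rw [hL, List.nodup_append, List.nodup_append, List.nodup_append]
    refine ⟨⟨Finset.nodup_toList _, Finset.nodup_toList _, ?_⟩,
      ⟨hE, Finset.nodup_toList _, ?_⟩, ?_⟩
    · rintro v hv w hw rfl
      exact (hS' v (by simpa using hw)).1 (by simpa using hv)
    · rintro v hv w hw rfl
      simp [hrest] at hw
      exact hw.2.2 hv
    · rintro v hv w hw rfl
      simp only [List.mem_append, Finset.mem_toList, hrest, Finset.mem_sdiff, Finset.mem_union,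
        List.mem_toFinset, Finset.mem_univ, true_and, not_or] at hv hw
      rcases hv with hv | hv <;> rcases hw with hw | hw
      · exact hEA v hw hv
      · exact hw.1.1 hv
      · exact (hS' v hv).2 hw
      · exact hw.1.2 hv
  have hfull : ∀ v, v ∈ L := by
    intro v
    simp only [hL, List.mem_append, Finset.mem_toList, hrest, Finset.mem_sdiff, Finset.mem_union,
        List.mem_toFinset, Finset.mem_univ, true_and]
    tauto
  have hlen : L.length = Fintype.card V := by
    rw [← List.toFinset_card_of_nodup hLnd]
    have : L.toFinset = Finset.univ := by ext w; simp [hfull]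
    rw [this, Finset.card_univ]
  have hlen1 : (A.toList ++ S'.toList).length = b := by
    rw [List.length_append, Finset.length_toList, Finset.length_toList, hcard]
    omega
  refine ⟨fun v => ⟨L.idxOf v, hlen ▸ List.idxOf_lt_length_of_mem (hfull v)⟩, ?_, ?_, ?_, ?_⟩
  · intro u v huv
    exact (List.idxOf_inj (hfull u)).1 (Fin.mk.inj huv)
  · intro v hv
    have hv' : v ∈ A.toList := by simpa using hv
    have h1 := List.idxOf_lt_length_of_mem hv'
    rw [Finset.length_toList] at h1
    simp only [hL, List.append_assoc]
    rwa [List.idxOf_append_of_mem hv']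
  · intro v hv
    have hv' : v ∈ A.toList ++ S'.toList := by
      rw [List.mem_append, Finset.mem_toList, Finset.mem_toList]
      by_cases hvA : v ∈ A
      · exact Or.inl hvA
      · exact Or.inr (hSS' (Finset.mem_sdiff.2 ⟨hv, hvA⟩))
    have h1 := List.idxOf_lt_length_of_mem hv'
    rw [hlen1] at h1
    simp only [hL]
    rwa [List.idxOf_append_of_mem hv']
  · intro i hi
    have hmem : E[i] ∈ E := List.getElem_mem hi
    have hn : E[i] ∉ A.toList ++ S'.toList := by
      rw [List.mem_append, Finset.mem_toList, Finset.mem_toList, not_or]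
      exact ⟨hEA _ hmem, fun h => (hS' _ h).2 hmem⟩
    simp only [hL]
    rw [List.idxOf_append_of_notMem hn, List.idxOf_append_of_mem hmem, hE.idxOf_getElem, hlen1,
      add_comm]

lemma isContained_of_numbering {A : Finset V} {H : SimpleGraph (Fin (Fintype.card V))}
    {φ : V → Fin (Fintype.card V)} (hφ : Function.Injective φ)
    (hA : ∀ u v, u ∈ A → u ≠ v → H.Adj (φ u) (φ v))
    (hoff : ∀ u v, (off G A).Adj u v → H.Adj (φ u) (φ v)) : G.IsContained H := by
  refine ⟨⟨⟨φ, fun {u v} huv => ?_⟩, hφ⟩⟩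
  by_cases hu : u ∈ A
  · exact hA u v hu huv.ne
  by_cases hv : v ∈ A
  · exact (hA v u hv huv.ne').symm
  exact hoff u v ⟨huv, hu, hv⟩

lemma graphH_adj_of_lt {n k a : ℕ} {i j : Fin n} (hij : i ≠ j) (ha : a ≤ k - a) (hi : i.val < a) :
    (graphH n k a).Adj i j := by
  refine ⟨hij, ?_⟩
  by_cases hj : j.val < k - a
  · exact Or.inl ⟨by omega, hj⟩
  · exact Or.inr (Or.inl ⟨hi, by omega⟩)

lemma isContained_graphH {A : Finset V} {k m : ℕ} (hk : 2 * A.card + m = k)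
    (hT : (nonIsolated (off G A)).card ≤ m) (hn : k ≤ Fintype.card V) :
    G.IsContained (graphH (Fintype.card V) k A.card) := by
  obtain ⟨φ, hφ, h1, h2, -⟩ := exists_numbering (A := A) (S := nonIsolated (off G A)) (E := [])
    (b := k - A.card) (by simp) (by simp) (by simp) (by omega) (by simp; omega)
  refine isContained_of_numbering (A := A) hφ (fun u v hu huv => ?_) fun u v huv => ?_
  · exact graphH_adj_of_lt (hφ.ne huv) (by omega) (h1 u hu)
  · exact ⟨hφ.ne huv.ne, Or.inl ⟨h2 u (mem_nonIsolated.2 ⟨v, huv⟩),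
      h2 v (mem_nonIsolated.2 ⟨u, huv.symm⟩)⟩⟩

lemma isContained_graphHPlus {A S : Finset V} {p q : V} {k m : ℕ} (hk : 2 * A.card + m = k)
    (hS : S.card ≤ m) (h : IsCliquePlusEdge (off G A) S p q) (hn : k + 2 ≤ Fintype.card V) :
    G.IsContained (graphHPlus (Fintype.card V) k A.card) := by
  -- The block below `k - |A|` is `A ∪ B`, so `p` and `q` become the first two vertices of `C`,
  -- where the extra edge sits.
  obtain ⟨φ, hφ, h1, h2, h3⟩ := exists_numbering (A := A) (S := S) (E := [p, q])
    (b := k - A.card) (by simp [h.adj.ne]) (by simp [h.adj.2.1, h.adj.2.2])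
    (by simp [h.left_notMem, h.right_notMem]) (by omega) (by simp; omega)
  have hp : (φ p).val = k - A.card := by simpa using h3 0 (by simp)
  have hq : (φ q).val = k - A.card + 1 := by simpa using h3 1 (by simp)
  refine isContained_of_numbering (A := A) hφ (fun u v hu huv => ?_) fun u v huv => ?_
  · exact Or.inl (graphH_adj_of_lt (hφ.ne huv) (by omega) (h1 u hu))
  · rcases h.cover u v huv with ⟨hu, hv⟩ | ⟨rfl, rfl⟩ | ⟨rfl, rfl⟩
    · exact Or.inl ⟨hφ.ne huv.ne, Or.inl ⟨h2 u hu, h2 v hv⟩⟩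
    · exact Or.inr ⟨hφ.ne huv.ne, Or.inl ⟨hp, hq⟩⟩
    · exact Or.inr ⟨hφ.ne huv.ne, Or.inr ⟨hp, hq⟩⟩

lemma isContained_graphHPlusPlus {A S : Finset V} {p q x y : V} {k m : ℕ}
    (hk : 2 * A.card + m = k) (hS : S.card ≤ m) (h : IsCliquePlusTwoEdges (off G A) S p q x y)
    (hn : k + 4 ≤ Fintype.card V) :
    G.IsContained (graphHPlusPlus (Fintype.card V) k A.card) := by
  obtain ⟨n1, n2, n3, n4⟩ := h.notMem
  obtain ⟨d1, d2, d3, d4⟩ := h.disjoint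
  obtain ⟨φ, hφ, h1, h2, h3⟩ := exists_numbering (A := A) (S := S) (E := [p, q, x, y])
    (b := k - A.card) (by simp [h.adj_left.ne, h.adj_right.ne, d1, d2, d3, d4])
    (by simp [h.adj_left.2.1, h.adj_left.2.2, h.adj_right.2.1, h.adj_right.2.2])
    (by simp [n1, n2, n3, n4]) (by omega) (by simp; omega)
  have hp : (φ p).val = k - A.card := by simpa using h3 0 (by simp)
  have hq : (φ q).val = k - A.card + 1 := by simpa using h3 1 (by simp)
  have hx : (φ x).val = k - A.card + 2 := by simpa using h3 2 (by simp)
  have hy : (φ y).val = k - A.card + 3 := by simpa using h3 3 (by simp)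
  refine isContained_of_numbering (A := A) hφ (fun u v hu huv => ?_) fun u v huv => ?_
  · exact Or.inl (graphH_adj_of_lt (hφ.ne huv) (by omega) (h1 u hu))
  · rcases h.cover u v huv with ⟨hu, hv⟩ | ⟨rfl, rfl⟩ | ⟨rfl, rfl⟩ | ⟨rfl, rfl⟩ | ⟨rfl, rfl⟩
    · exact Or.inl ⟨hφ.ne huv.ne, Or.inl ⟨h2 u hu, h2 v hv⟩⟩
    · exact Or.inr ⟨hφ.ne huv.ne, Or.inl (Or.inl ⟨hp, hq⟩)⟩
    · exact Or.inr ⟨hφ.ne huv.ne, Or.inr (Or.inl ⟨hp, hq⟩)⟩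
    · exact Or.inr ⟨hφ.ne huv.ne, Or.inl (Or.inr ⟨hx, hy⟩)⟩
    · exact Or.inr ⟨hφ.ne huv.ne, Or.inr (Or.inr ⟨hx, hy⟩)⟩

end

/-! ### Clique counts by the size of the core -/

lemma LinksLT.card_clique_le {k : ℕ} (h : LinksLT G k) {K : Finset V} (hK : G.IsClique K) :
    K.card ≤ k := by
  by_contra hn
  have hl := h K.toList (Finset.nodup_toList K)
  obtain ⟨p, x, y, q, hsplit, hxy⟩ := exists_not_adj_of_links_add_one_lt (G := G) (l := K.toList)
    (by rw [Finset.length_toList]; omega)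
  have hnd := Finset.nodup_toList K
  rw [hsplit] at hnd
  have hne : x ≠ y := by
    rintro rfl
    simp [List.nodup_append] at hnd
  have hx : x ∈ K.toList := by rw [hsplit]; simp
  have hy : y ∈ K.toList := by rw [hsplit]; simp
  rw [Finset.mem_toList] at hx hy
  exact hxy (hK hx hy hne)

section

variable [Fintype V]

open scoped Classical

lemma card_sub_one_le_degree {K : Finset V} (hK : G.IsClique K) {v : V} (hv : v ∈ K) :
    K.card ≤ G.degree v + 1 := by
  rw [← Finset.card_erase_add_one hv, ← SimpleGraph.card_neighborFinset_eq_degree]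
  refine Nat.add_le_add_right (Finset.card_le_card fun w hw => ?_) 1
  rw [SimpleGraph.mem_neighborFinset]
  exact hK hv (Finset.mem_of_mem_erase hw) (Finset.ne_of_mem_erase hw).symm

/-- A closed graph with a large clique has few cliques. -/
lemma LinksLT.card_cliqueFinset_le_of_clique {k d q t : ℕ} (h : LinksLT G k)
    (hclosed : ∀ u v, u ≠ v → ¬ G.Adj u v → G.degree u + G.degree v < k)
    (hcard : k < Fintype.card V) (hd : ∀ v, d ≤ G.degree v) (htk : t ≤ k)
    (hK : k ≤ G.cliqueNum + t) :
    (G.cliqueFinset (q + 2)).card ≤ max (hCliques (q + 2) (Fintype.card V) k d)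
      (hCliques (q + 2) (Fintype.card V) k t) := by
  obtain ⟨K, hKc⟩ := G.exists_isNClique_cliqueNum
  have hc := hKc.card_eq
  have hck := h.card_clique_le hKc.isClique
  -- By maximality `u` misses some `w ∈ K`, whose degree is at least `|K| - 1`; closedness bounds
  -- the degree of `u`.
  have hout : ∀ u, u ∉ K → G.degree u ≤ k - K.card := by
    intro u hu
    obtain ⟨w, hw, huw⟩ : ∃ w ∈ K, ¬ G.Adj u w := by
      by_contra hn
      push Not at hn
      have hins : G.IsClique (insert u K : Finset V) := by
        rw [Finset.coe_insert]
        exact hKc.isClique.insert fun b hb _ => hn b hb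
      have := hins.card_le_cliqueNum
      rw [Finset.card_insert_of_notMem hu] at this
      omega
    have h1 := hclosed u w (by rintro rfl; exact hu hw) huw
    have h2 := card_sub_one_le_degree hKc.isClique hw
    omega
  obtain ⟨u, hu⟩ : ∃ u, u ∉ K := by
    by_contra hn
    push Not at hn
    have : K = Finset.univ := Finset.eq_univ_of_forall hn
    rw [this, Finset.card_univ] at hck
    omega
  -- The count is at most `h_r(n, k, k - |K|)`, and `k - |K|` lies between `d` and `t`.
  refine le_trans ?_ (hCliques_le_max (b := k - K.card) ((hd u).trans (hout u hu)) (by omega) htk)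
  refine (card_cliqueFinset_le_choose_add_sum K (q + 1)).trans ?_
  have e1 : k - (k - K.card) = K.card := by omega
  have e2 : Fintype.card V - k + (k - K.card) = Kᶜ.card := by
    rw [Finset.card_compl]; omega
  simp only [hCliques, e1, e2]
  refine Nat.add_le_add_left ?_ _
  rw [← smul_eq_mul]
  exact Finset.sum_le_card_nsmul _ _ _ fun v hv =>
    Nat.choose_le_choose _ (hout v (Finset.mem_compl.1 hv))

/-- A closed graph with few universal vertices and without large cliques has few cliques. -/
lemma IsCore.card_cliqueFinset_le_of_cliqueNum {k q t m : ℕ} {A : Finset V}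
    (hA : IsCore G k A m)
    (hclosed : ∀ u v, u ≠ v → ¬ G.Adj u v → G.degree u + G.degree v < k)
    (hn : k ^ 5 < Fintype.card V) (hkt : 2 * t + 5 ≤ k) (hkt' : k ≤ 2 * t + 6) (hqt : q + 1 ≤ t)
    (hat : A.card < t) (hK : G.cliqueNum + t < k) :
    (G.cliqueFinset (q + 2)).card ≤ hCliques (q + 2) (Fintype.card V) k t := by
  -- Vertices of degree at least `k / 2` are pairwise adjacent, so there are fewer than `k - t` of
  -- them. All others have degree at most `t + 2`, because `k ≤ 2 * t + 6`, and exactly `|A|` if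
  -- isolated outside `A`.
  set W := Finset.univ.filter fun v => k ≤ 2 * G.degree v with hW
  have hWc : G.IsClique (W : Set V) := by
    intro u hu v hv hne
    by_contra hn
    have h1 := hclosed u v hne hn
    simp only [hW, Finset.coe_filter, Finset.mem_univ, true_and, Set.mem_ofPred_eq] at hu hv
    omega
  have hWcard := hWc.card_le_cliqueNum
  have hkn : k ≤ Fintype.card V - 1 := by
    have : k ≤ k ^ 5 := Nat.le_self_pow (by norm_num) k
    omega
  have hAW : ∀ v ∈ A, v ∈ W := by
    intro v hv
    have h1 : (Finset.univ.erase v).card ≤ G.degree v := by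
      rw [← SimpleGraph.card_neighborFinset_eq_degree]
      refine Finset.card_le_card fun w hw => ?_
      rw [SimpleGraph.mem_neighborFinset]
      exact hA.universal v hv w (Finset.ne_of_mem_erase hw)
    rw [Finset.card_erase_of_mem (Finset.mem_univ _), Finset.card_univ] at h1
    simp only [hW, Finset.mem_filter, Finset.mem_univ, true_and]
    omega
  refine le_trans ?_ (choose_add_le_hCliques (w := W.card) (a := A.card)
    (T := (nonIsolated (off G A)).card) hn hkt hqt hat (by omega) hA.card_nonIsolated)
  refine (card_cliqueFinset_le_choose_add_sum W (q + 1)).trans ?_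
  rw [add_assoc (W.card.choose _)]
  refine Nat.add_le_add_left ?_ _
  calc ∑ v ∈ Wᶜ, (G.degree v).choose (q + 1)
      ≤ ∑ v ∈ Wᶜ, ((if v ∈ nonIsolated (off G A) then (t + 2).choose (q + 1) else 0) +
          A.card.choose (q + 1)) := by
        refine Finset.sum_le_sum fun v hv => ?_
        have hvW : ¬ k ≤ 2 * G.degree v := by simpa [hW] using hv
        by_cases hvT : v ∈ nonIsolated (off G A)
        · rw [if_pos hvT]
          exact (Nat.choose_le_choose _ (by omega)).trans (Nat.le_add_right _ _)
        · have hvA : v ∉ A := fun h => Finset.mem_compl.1 hv (hAW v h)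
          have h0 : (off G A).degree v = 0 := by
            by_contra h0
            exact hvT (mem_nonIsolated.2
              (((off G A).degree_pos_iff_exists_adj v).1 (Nat.pos_of_ne_zero h0)))
          rw [if_neg hvT, hA.degree_eq v hvA, h0, zero_add, zero_add]
    _ ≤ ∑ v : V, ((if v ∈ nonIsolated (off G A) then (t + 2).choose (q + 1) else 0) +
          A.card.choose (q + 1)) :=
        Finset.sum_le_sum_of_subset (Finset.subset_univ _)
    _ = _ := by
        rw [Finset.sum_add_distrib, Finset.sum_ite_mem, Finset.univ_inter, Finset.sum_const,
          Finset.sum_const, Finset.card_univ, smul_eq_mul, smul_eq_mul]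

lemma IsCore.card_cliqueFinset_le {k d q t m : ℕ} {A : Finset V} (hA : IsCore G k A m)
    (h : LinksLT G k) (hclosed : ∀ u v, u ≠ v → ¬ G.Adj u v → G.degree u + G.degree v < k)
    (hd : ∀ v, d ≤ G.degree v) (hn : k ^ 5 < Fintype.card V) (hkt : 2 * t + 5 ≤ k)
    (hkt' : k ≤ 2 * t + 6) (hqt : q + 1 ≤ t) (hat : A.card ≤ t) :
    (G.cliqueFinset (q + 2)).card ≤ max (hCliques (q + 2) (Fintype.card V) k d)
      (hCliques (q + 2) (Fintype.card V) k t) := by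
  have hkn : k < Fintype.card V := (Nat.le_self_pow (by norm_num) k).trans_lt hn
  have hcard := hA.card_add
  rcases hat.lt_or_eq with hat | hat
  · by_cases hK : k ≤ G.cliqueNum + t
    · exact h.card_cliqueFinset_le_of_clique hclosed hkn hd (by omega) hK
    · exact le_max_of_le_right
        (hA.card_cliqueFinset_le_of_cliqueNum hclosed hn hkt hkt' hqt hat (by omega))
  · refine le_max_of_le_right ?_
    -- Here `m = k - 2 * t` is 5 or 6.
    have he := hA.linksLT.card_edges_le (by omega) hA.degree_lt hA.closed
    refine (card_cliqueFinset_le_of_off hA.degree_lt he (q + 1) (by omega)).trans ?_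
    have e1 : k - t = A.card + m := by omega
    have e2 : Fintype.card V - k + t = Fintype.card V - A.card - m := by omega
    simp only [hCliques, e1, e2]
    rw [hat]

/-- A graph whose core misses a linear forest of size at most four lies in an extremal graph. -/
lemma IsCore.isContained {k m : ℕ} {A : Finset V} (hA : IsCore G k A m) (hm : m ≤ 4)
    (hk : 3 ≤ k) (hn : k + 2 ≤ Fintype.card V) :
    (Odd k →
      G.IsContained (graphH (Fintype.card V) k ((k - 1) / 2)) ∨
      G.IsContained (graphH (Fintype.card V) k ((k - 3) / 2)) ∨
      G.IsContained (graphHPlus (Fintype.card V) (k - 1) ((k - 3) / 2))) ∧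
    (Even k →
      G.IsContained (graphH (Fintype.card V) k ((k - 1) / 2)) ∨
      G.IsContained (graphH (Fintype.card V) k ((k - 3) / 2)) ∨
      G.IsContained (graphHPlus (Fintype.card V) (k - 1) ((k - 3) / 2)) ∨
      G.IsContained (graphHPlusPlus (Fintype.card V) (k - 2) ((k - 3) / 2))) := by
  have hcard := hA.card_add
  have hpos := hA.pos
  have hfull : ∀ x, (off G A).degree x + 1 = m →
      G.IsContained (graphH (Fintype.card V) k A.card) := fun x hx =>
    isContained_graphH hcard (card_nonIsolated_le_of_degree hA.closed hx) (by omega)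
  obtain ⟨w, -, hw⟩ := hA.exists_isolated
  have hlow : m ≤ 2 → G.IsContained (graphH (Fintype.card V) k A.card) := by
    intro hm2
    by_cases hx : ∃ x, (off G A).degree x + 1 = m
    · exact hfull _ hx.choose_spec
    · push Not at hx
      refine isContained_graphH hcard ?_ (by omega)
      rw [Nat.le_iff_lt_or_eq]
      left
      refine lt_of_eq_of_lt (Finset.card_eq_zero.2 (Finset.eq_empty_of_forall_notMem ?_)) hpos
      intro v hv
      have h1 := ((off G A).degree_pos_iff_exists_adj v).2 (mem_nonIsolated.1 hv)
      have h2 := hA.degree_lt v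
      have h3 := hx v
      omega
  rcases (show m = 1 ∨ m = 2 ∨ m = 3 ∨ m = 4 by omega) with rfl | rfl | rfl | rfl
  · have e : (k - 1) / 2 = A.card := by omega
    rw [e]
    exact ⟨fun _ => Or.inl (hlow (by omega)), fun _ => Or.inl (hlow (by omega))⟩
  · have e : (k - 1) / 2 = A.card := by omega
    rw [e]
    exact ⟨fun _ => Or.inl (hlow (by omega)), fun _ => Or.inl (hlow (by omega))⟩
  · have e : (k - 3) / 2 = A.card := by omega
    rw [e]
    rcases hA.linksLT.structure_three hA.degree_lt hA.closed with h | ⟨S, p, q, hS, h⟩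
    · have := isContained_graphH hcard h (by omega)
      exact ⟨fun _ => Or.inr (Or.inl this), fun _ => Or.inr (Or.inl this)⟩
    -- The set `S` has one vertex less than `m`, hence the parameter `k - 1`; with two extra edges
    -- below it becomes `k - 2`.
    · have := isContained_graphHPlus (k := k - 1) (m := 2) (by omega) hS h (by omega)
      exact ⟨fun _ => Or.inr (Or.inr this), fun _ => Or.inr (Or.inr (Or.inl this))⟩
  · have e : (k - 3) / 2 = A.card := by omega
    rw [e]
    have hodd : ¬ Odd k := by rw [Nat.not_odd_iff]; omega
    refine ⟨fun h => absurd h hodd, fun _ => ?_⟩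
    rcases hA.linksLT.structure_four hA.degree_lt hA.closed with
      h | ⟨S, p, q, hS, h⟩ | ⟨S, p, q, x, y, hS, h⟩
    · exact Or.inr (Or.inl (isContained_graphH hcard h (by omega)))
    · exact Or.inr (Or.inr (Or.inl
        (isContained_graphHPlus (k := k - 1) (m := 3) (by omega) hS h (by omega))))
    · exact Or.inr (Or.inr (Or.inr
        (isContained_graphHPlusPlus (k := k - 2) (m := 2) (by omega) hS h (by omega))))

end

lemma two_mul_sq_add_lt_pow_five {k : ℕ} (hk : 7 ≤ k) : 2 * k * k + 2 * k < k ^ 5 := by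
  have h1 : 7 * (7 * (7 * (k * k))) ≤ k * (k * (k * (k * k))) := by gcongr
  have h2 : k ≤ k * k := Nat.le_mul_of_pos_right _ (by omega)
  have h3 : k ^ 5 = k * (k * (k * (k * k))) := by ring
  rw [h3]
  nlinarith

end LinearForests

/-! ### The theorem -/

open LinearForests in
theorem theorem1p4 {V : Type*} [Fintype V] [DecidableEq V] (G : SimpleGraph V)
    [DecidableRel G.Adj] (n k d r : ℕ)
    (hcard : Fintype.card V = n)
    (hfree : LinearForestFree k G)
    (hdeg : d ≤ G.minDegree)
    (hn : k ^ 5 < n)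
    (hr : r ≤ (k - 3) / 2)
    (hN : max (hCliques r n k d) (hCliques r n k ((k - 5) / 2)) < (G.cliqueFinset r).card) :
    (Odd k →
      G.IsContained (graphH n k ((k - 1) / 2)) ∨
      G.IsContained (graphH n k ((k - 3) / 2)) ∨
      G.IsContained (graphHPlus n (k - 1) ((k - 3) / 2))) ∧
    (Even k →
      G.IsContained (graphH n k ((k - 1) / 2)) ∨
      G.IsContained (graphH n k ((k - 3) / 2)) ∨
      G.IsContained (graphHPlus n (k - 1) ((k - 3) / 2)) ∨
      G.IsContained (graphHPlusPlus n (k - 2) ((k - 3) / 2))) := by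
  classical
  subst hcard
  have hkn : k < Fintype.card V := (Nat.le_self_pow (by norm_num) k).trans_lt hn
  -- For `r = 0` and `r = 1` the bound `h_r` equals 1 and `n`, which no graph exceeds.
  obtain ⟨q, rfl⟩ : ∃ q, r = q + 2 := by
    have h1 := (le_max_right _ _).trans_lt hN
    have h2 := G.card_cliqueFinset_le (n := r)
    rcases r with _ | _ | q
    · simp only [hCliques, Nat.choose_zero_right] at h1 h2
      omega
    · simp only [hCliques, zero_add, Nat.choose_one_right, Nat.choose_zero_right, mul_one] at h1 h2
      omega
    · exact ⟨q, rfl⟩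
  have hk7 : 7 ≤ k := by omega
  have hpow := two_mul_sq_add_lt_pow_five hk7
  obtain ⟨G', hle, hlinks, hclosed⟩ :=
    (linksLT_of_linearForestFree hfree).exists_closure hkn
  obtain ⟨A, m, hA⟩ := exists_isCore hlinks hclosed (by omega)
  have hd : ∀ v, d ≤ G'.degree v := fun v =>
    (hdeg.trans (G.minDegree_le_degree v)).trans (SimpleGraph.degree_le_of_le hle)
  have hcardA := hA.card_add
  have hpos := hA.pos
  -- This inequality amounts to `m ≤ 4`.
  have hlt : (k - 5) / 2 < A.card := by
    by_contra hle'
    have h1 := hA.card_cliqueFinset_le (d := d) (q := q) (t := (k - 5) / 2) hlinks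
      hclosed hd hn (by omega) (by omega) (by omega) (by omega)
    have h2 : (G.cliqueFinset (q + 2)).card ≤ (G'.cliqueFinset (q + 2)).card :=
      Finset.card_le_card (SimpleGraph.cliqueFinset_mono _ hle)
    refine absurd (hN.trans_le (h2.trans (le_of_eq_of_le ?_ h1))) (lt_irrefl _)
    congr!
  have hmain := hA.isContained (by omega) (by omega) (by omega)
  have hG : ∀ {H : SimpleGraph (Fin (Fintype.card V))}, G'.IsContained H → G.IsContained H :=
    fun h => h.mono_left hle
  exact ⟨fun h => (hmain.1 h).imp hG (Or.imp hG hG),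
    fun h => (hmain.2 h).imp hG (Or.imp hG (Or.imp hG hG))⟩
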